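/- Let $N$ be a complex manifold of complex dimension $n$ with a Kähler–Einstein metric $g$, $\mathrm{Ric}(g)=t\,g$ with $t>0$, complex structure $J$ and Kähler form $\omega=g(J\cdot,\cdot)$. Let $\pi\colon K(N)\to N$ be the total space of the canonical bundle $\Lambda^{n,0}T^*N$, with the Hermitian norm for which $\theta_1\wedge\dots\wedge\theta_n$ has length one if $(\theta_j)$ is dual to a unitary frame, and with the connection induced by the Levi-Civita connection of $g$. Let $\rho$ be the tautological $n$-form on $K(N)$, $\rho_p(v_1,\dots,v_n)=p(\pi_*v_1,\dots,\pi_*v_n)$, and let $\varphi=d\rho$. Let $r^2$ be the squared length on $K(N)$, let $u(s)=(ts+c)^{1/(n+1)}$ with a constant $c>0$, and let $$\omega_u=u(r^2)\,\pi^*\omega+i\,t^{-1}u'(r^2)\,b\wedge\bar b$$ be the Kähler form of the Calabi metric, where $b$ is the projection of $TK(N)$ to the vertical space along the horizontal distribution, written in a unitary coordinate of the fibre; thus the horizontal and the vertical distribution are orthogonal. An immersed submanifold of $K(N)$ of real dimension $n+1$ is called special Lagrangian if $\omega_u$ and $\operatorname{Im}\varphi$ restrict to zero on it. Let $\iota\colon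 L\to N$ be a Lagrangian immersion of an oriented smooth $n$-manifold. Then for every $l\in L$ there is a unique $\kappa_l\in K(N)_{\iota(l)}$ which restricts to the volume form of $(L,\iota^*g)$ on $T_lL$. Let $L^K=\{a\kappa_l : l\in L,\ a\in\mathbb R\}\subset K(N)$, parametrized by $L\times\mathbb R$, $(l,a)\mapsto a\kappa_l$; this map is a topological embedding if $\iota$ is one. Then $L$ is minimal, that is, the trace of its second fundamental form vanishes, if and only if $L^K$ is a special Lagrangian immersed submanifold of $K(N)$. -/

import Mathlib

open scoped Manifold ContDiff ComplexConjugate Topology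

set_option maxSynthPendingDepth 3

namespace MinLag

noncomputable section

/-- The model space `ℂⁿ` of a complex `n`-manifold, also used as a real vector space. -/
abbrev Cn (n : ℕ) : Type := EuclideanSpace ℂ (Fin n)

/-- A complex manifold is a real-analytic manifold, with the same charts. -/
instance isManifold_real {n : ℕ} (N : Type*) [TopologicalSpace N] [ChartedSpace (Cn n) N]
    [IsManifold 𝓘(ℂ, Cn n) ω N] : IsManifold 𝓘(ℝ, Cn n) ω N := by
  refine isManifold_of_contDiffOn _ _ _ fun e e' he he' => ?_
  have h := (mem_groupoid_of_pregroupoid.1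
    (HasGroupoid.compatible (G := contDiffGroupoid ω 𝓘(ℂ, Cn n)) he he')).1
  exact ContDiffOn.restrict_scalars ℝ h

/-! ### The canonical bundle -/

/-- The form `dz₁ ∧ … ∧ dzₙ` on `ℂⁿ`, as a complex valued real alternating form. -/
def dzForm (n : ℕ) : Cn n [⋀^Fin n]→L[ℝ] ℂ :=
  { (EuclideanSpace.basisFun (Fin n) ℂ).toBasis.det.restrictScalars ℝ with
    map_eq_zero_of_eq' := fun v i j h hij =>
      (EuclideanSpace.basisFun (Fin n) ℂ).toBasis.det.map_eq_zero_of_eq v h hij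
    cont := by
      change Continuous fun v : Fin n → Cn n => (EuclideanSpace.basisFun (Fin n) ℂ).toBasis.det v
      simp only [Module.Basis.det_apply]
      refine Continuous.matrix_det (continuous_matrix fun i j => ?_)
      simp only [Module.Basis.toMatrix_apply, OrthonormalBasis.coe_toBasis_repr_apply,
        EuclideanSpace.basisFun_repr]
      fun_prop }

variable (n : ℕ) (N : Type*) [TopologicalSpace N] [ChartedSpace (Cn n) N]
  [IsManifold 𝓘(ℂ, Cn n) ω N]

/-- The canonical bundle `Λ^{n,0} T*N` as a holomorphic line bundle given by its transition
functions: over a chart `z` an element is written `y dz₁ ∧ … ∧ dzₙ` with `y : ℂ`, and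
`y' = det (∂z/∂z') y` over another chart `z'`. -/
def canonicalCore : VectorBundleCore ℂ N ℂ (atlas (Cn n) N) where
  baseSet i := i.1.source
  isOpen_baseSet i := i.1.open_source
  indexAt := achart (Cn n)
  mem_baseSet_at := mem_chart_source (Cn n)
  coordChange i j x :=
    ((tangentBundleCore 𝓘(ℂ, Cn n) N).coordChange j i x).det • ContinuousLinearMap.id ℂ ℂ
  coordChange_self i x hx v := by
    have : (tangentBundleCore 𝓘(ℂ, Cn n) N).coordChange i i x = ContinuousLinearMap.id ℂ _ :=
      ContinuousLinearMap.ext fun w => (tangentBundleCore 𝓘(ℂ, Cn n) N).coordChange_self i x hx w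
    rw [this]
    simp [ContinuousLinearMap.det]
  continuousOn_coordChange i j := by
    have h := (tangentBundleCore 𝓘(ℂ, Cn n) N).continuousOn_coordChange j i
    rw [Set.inter_comm] at h
    exact (ContinuousLinearMap.continuous_det.comp_continuousOn h).smul continuousOn_const
  coordChange_comp i j k x hx v := by
    have : (tangentBundleCore 𝓘(ℂ, Cn n) N).coordChange k i x =
        ((tangentBundleCore 𝓘(ℂ, Cn n) N).coordChange j i x).comp
          ((tangentBundleCore 𝓘(ℂ, Cn n) N).coordChange k j x) :=
      ContinuousLinearMap.ext fun w =>
        ((tangentBundleCore 𝓘(ℂ, Cn n) N).coordChange_comp k j i x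
          ⟨⟨hx.2, hx.1.2⟩, hx.1.1⟩ w).symm
    rw [this]
    simp only [ContinuousLinearMap.det, ContinuousLinearMap.toLinearMap_comp, LinearMap.det_comp,
      smul_apply, ContinuousLinearMap.id_apply, smul_eq_mul]
    ring

/-- The fibre `K_x` of the canonical bundle. Like `T_xN`, it is coordinatized by the preferred
chart at `x`: `a : ℂ` stands for the form `a dz₁ ∧ … ∧ dzₙ` in this chart. -/
abbrev CanonicalFiber (x : N) : Type := (canonicalCore n N).Fiber x

/-- The total space `K(N)` of the canonical bundle. -/
abbrev CanonicalBundle : Type _ := Bundle.TotalSpace ℂ (CanonicalFiber n N)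

/-- The model with corners of `K(N)` as a real manifold. -/
abbrev modelK (n : ℕ) : ModelWithCorners ℝ (Cn n × ℂ) (ModelProd (Cn n) ℂ) :=
  𝓘(ℝ, Cn n).prod 𝓘(ℝ, ℂ)

variable {n N}

/-- An element of `K_x`, seen as an alternating `n`-form on `T_xN`. -/
def fiberForm (x : N) (a : CanonicalFiber n N x) : TangentSpace 𝓘(ℝ, Cn n) x [⋀^Fin n]→L[ℝ] ℂ :=
  (show ℂ from a) • dzForm n

/-- The tautological form `ρ` on `K(N)`: `ρ_p (v₁, …, vₙ) = p (π_* v₁, …, π_* vₙ)`. -/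
def tautologicalForm (p : CanonicalBundle n N) : TangentSpace (modelK n) p [⋀^Fin n]→L[ℝ] ℂ :=
  (fiberForm p.proj p.snd).compContinuousLinearMap
    (mfderiv (modelK n) 𝓘(ℝ, Cn n) (Bundle.TotalSpace.proj : CanonicalBundle n N → N) p)

/-- Exterior derivative of a differential form on a manifold without boundary: at `p`, it is the
exterior derivative of the expression of the form in the preferred chart at `p`. -/
def mextDeriv {V H M F : Type*} [NormedAddCommGroup V] [NormedSpace ℝ V] [TopologicalSpace H]
    (I : ModelWithCorners ℝ V H) [I.Boundaryless] [TopologicalSpace M] [ChartedSpace H M]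
    [NormedAddCommGroup F] [NormedSpace ℝ F] {k : ℕ}
    (η : ∀ p : M, TangentSpace I p [⋀^Fin k]→L[ℝ] F) (p : M) :
    TangentSpace I p [⋀^Fin (k + 1)]→L[ℝ] F :=
  extDeriv (E := V) (fun z => (η ((extChartAt I p).symm z)).compContinuousLinearMap
    (mfderiv 𝓘(ℝ, V) I (extChartAt I p).symm z)) (extChartAt I p p)

/-- The holomorphic volume form `φ = dρ` on `K(N)`. -/
def holVolumeForm (p : CanonicalBundle n N) : TangentSpace (modelK n) p [⋀^Fin (n + 1)]→L[ℝ] ℂ :=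
  mextDeriv (modelK n) (tautologicalForm (n := n) (N := N)) p

/-! ### Levi-Civita connection and Ricci curvature of a metric on an open set of a vector space -/

section Chart

variable {V : Type*} [NormedAddCommGroup V] [NormedSpace ℝ V]

/-- Christoffel symbols of the first kind of a metric `G`:
`[v w, y] = (D_v G(w, y) + D_w G(v, y) - D_y G(v, w)) / 2`. -/
def christoffelFirst (G : V → V →L[ℝ] V →L[ℝ] ℝ) (z : V) : V →L[ℝ] V →L[ℝ] V →L[ℝ] ℝ :=
  (2⁻¹ : ℝ) • (fderiv ℝ G z + (fderiv ℝ G z).flip -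
    ((ContinuousLinearMap.flipₗᵢ ℝ V V ℝ).toContinuousLinearEquiv.toContinuousLinearMap.comp
      (fderiv ℝ G z).flip))

/-- Christoffel symbols of a metric `G`: `G (Γ(v, w), y) = [v w, y]` for all `y`. -/
def christoffel (G : V → V →L[ℝ] V →L[ℝ] ℝ) (z : V) : V →L[ℝ] V →L[ℝ] V :=
  (ContinuousLinearMap.compL ℝ V (V →L[ℝ] ℝ) V (G z).inverse).comp (christoffelFirst G z)

/-- The curvature `R(u, v) w` of a metric `G`, as a linear map in `u`. -/
def curvature (G : V → V →L[ℝ] V →L[ℝ] ℝ) (z v w : V) : V →ₗ[ℝ] V where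
  toFun u := fderiv ℝ (christoffel G) z u v w - fderiv ℝ (christoffel G) z v u w
    + christoffel G z u (christoffel G z v w) - christoffel G z v (christoffel G z u w)
  map_add' := by intros; simp; abel
  map_smul' := by intros; simp [smul_sub, smul_add]

/-- The Ricci curvature `Ric(v, w) = tr (u ↦ R(u, v) w)` of a metric `G`. -/
def ricci (G : V → V →L[ℝ] V →L[ℝ] ℝ) (z v w : V) : ℝ :=
  LinearMap.trace ℝ V (curvature G z v w)

end Chart

/-! ### Kähler-Einstein metrics -/

variable (n N) in
/-- Smooth Riemannian metrics on the complex manifold `N`. -/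
abbrev RMetric : Type _ :=
  Bundle.ContMDiffRiemannianMetric 𝓘(ℝ, Cn n) ∞ (Cn n) (fun x : N => TangentSpace 𝓘(ℝ, Cn n) x)

/-- `g_x(v, w)`, with `T_xN` coordinatized by the preferred chart at `x`. -/
def inn (g : RMetric n N) (x : N) : Cn n →L[ℝ] Cn n →L[ℝ] ℝ := g.inner x

/-- The metric `g` in the coordinates of the preferred chart at `x`. -/
def chartMetric (g : RMetric n N) (x : N) (z : Cn n) : Cn n →L[ℝ] Cn n →L[ℝ] ℝ :=
  (inn g ((extChartAt 𝓘(ℝ, Cn n) x).symm z)).bilinearComp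
    (mfderiv 𝓘(ℝ, Cn n) 𝓘(ℝ, Cn n) (extChartAt 𝓘(ℝ, Cn n) x).symm z : Cn n →L[ℝ] Cn n)
    (mfderiv 𝓘(ℝ, Cn n) 𝓘(ℝ, Cn n) (extChartAt 𝓘(ℝ, Cn n) x).symm z : Cn n →L[ℝ] Cn n)

/-- The Christoffel symbols of `g` at `x`, in the preferred chart at `x`. -/
def Gam (g : RMetric n N) (x : N) : Cn n →L[ℝ] Cn n →L[ℝ] Cn n :=
  christoffel (chartMetric g x) (extChartAt 𝓘(ℝ, Cn n) x x)

/-- The Ricci curvature of `g` at `x`. -/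
def ric (g : RMetric n N) (x : N) (v w : Cn n) : ℝ :=
  ricci (chartMetric g x) (extChartAt 𝓘(ℝ, Cn n) x x) v w

/-- The Kähler form `ω(v, w) = g(Jv, w)`. -/
def kahlerForm (g : RMetric n N) (x : N) (v w : Cn n) : ℝ := inn g x (Complex.I • v) w

/-- `g` is a Kähler-Einstein metric with `Ric = t g`. -/
structure IsKahlerEinstein (g : RMetric n N) (t : ℝ) : Prop where
  /-- `g` is Hermitian: the complex structure `J` acts by isometries. -/
  hermitian : ∀ (x : N) (v w : Cn n), inn g x (Complex.I • v) (Complex.I • w) = inn g x v w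
  /-- `dω = 0`, that is `D_u ω(v, w) + D_v ω(w, u) + D_w ω(u, v) = 0` in holomorphic coordinates,
  in which `J` is multiplication by `i`. -/
  closed : ∀ (x : N) (u v w : Cn n),
    fderiv ℝ (chartMetric g x) (extChartAt 𝓘(ℝ, Cn n) x x) u (Complex.I • v) w
      + fderiv ℝ (chartMetric g x) (extChartAt 𝓘(ℝ, Cn n) x x) v (Complex.I • w) u
      + fderiv ℝ (chartMetric g x) (extChartAt 𝓘(ℝ, Cn n) x x) w (Complex.I • u) v = 0
  einstein : ∀ (x : N) (v w : Cn n), ric g x v w = t * inn g x v w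

/-! ### The Calabi metric on the canonical bundle -/

/-- The Hermitian Gram matrix `h(e_i, e_j) = g(e_i, e_j) + i g(e_i, J e_j)` of the coordinate basis
at `x`. -/
def hermGram (g : RMetric n N) (x : N) : Matrix (Fin n) (Fin n) ℂ :=
  Matrix.of fun i j =>
    (inn g x (EuclideanSpace.single i 1) (EuclideanSpace.single j 1) : ℂ)
      + Complex.I * inn g x (EuclideanSpace.single i 1) (Complex.I • EuclideanSpace.single j 1)

/-- The squared norm of `dz₁ ∧ … ∧ dzₙ` at `x`, for the Hermitian norm on the canonical bundle
for which `θ₁ ∧ … ∧ θₙ` has norm one if `θ` is the dual frame of a unitary frame. -/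
def dzNormSq (g : RMetric n N) (x : N) : ℝ := ((hermGram g x).det.re)⁻¹

/-- The Hermitian metric `⟨a, b⟩` on the fibre `K_x`; the form is conjugate linear in `b`. -/
def fiberInner (g : RMetric n N) (x : N) (a b : ℂ) : ℂ := dzNormSq g x * (a * conj b)

/-- The function `r²` on `K(N)`, the squared length. -/
def rSq (g : RMetric n N) (p : CanonicalBundle n N) : ℝ := (fiberInner g p.proj p.snd p.snd).re

/-- The connection form of `K(N)` in the frame `dz₁ ∧ … ∧ dzₙ` of the preferred chart at `x`, that is
`∇_v (dz₁ ∧ … ∧ dzₙ) = (connForm v) dz₁ ∧ … ∧ dzₙ`, where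
`∇_v (dz₁ ∧ … ∧ dzₙ) (e₁, …, eₙ) = - ∑ j, dz₁ ∧ … ∧ dzₙ (e₁, …, Γ(v, e_j), …, eₙ)`. -/
def connForm (g : RMetric n N) (x : N) (v : Cn n) : ℂ :=
  - ∑ j : Fin n, dzForm n (Function.update (fun i => EuclideanSpace.single i (1 : ℂ)) j
      (Gam g x v (EuclideanSpace.single j 1)))

/-- The projection `b` of `T_pK(N)` to the vertical space `K_{π(p)}` along the horizontal
distribution; in coordinates `b = dy + y ψ` where `ψ` is the connection form. -/
def vertPart (g : RMetric n N) (p : CanonicalBundle n N) (X : Cn n × ℂ) : ℂ :=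
  X.2 + (show ℂ from p.snd) * connForm g p.proj X.1

/-- The Riemannian metric on `K(N)` with profile `u`: the horizontal and the vertical distribution
are orthogonal, it is `u(r²) π^*g` on the horizontal one and `t⁻¹ u'(r²)` times the fibre metric on
the vertical one. The fibre metric is `2 Re ⟨ , ⟩`, the one whose Kähler form is `i b ∧ b̄` for
a unitary coordinate. -/
def calabiMetric (g : RMetric n N) (t : ℝ) (u : ℝ → ℝ) (p : CanonicalBundle n N) (X Y : Cn n × ℂ) : ℝ :=
  u (rSq g p) * inn g p.proj X.1 Y.1
    + t⁻¹ * deriv u (rSq g p) * (2 * (fiberInner g p.proj (vertPart g p X) (vertPart g p Y)).re)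

/-- The Kähler form `ω_u(X, Y) = g_u(JX, Y)` on `K(N)`. -/
def calabiForm (g : RMetric n N) (t : ℝ) (u : ℝ → ℝ) (p : CanonicalBundle n N)
    (X Y : TangentSpace (modelK n) p) : ℝ :=
  calabiMetric g t u p (Complex.I • (show Cn n × ℂ from X)) Y

/-- The profile `u(s) = (t s + c)^{1/(n+1)}` of the Calabi metric. -/
def calabiProfile (n : ℕ) (t c : ℝ) (s : ℝ) : ℝ := (t * s + c) ^ ((1 : ℝ) / (n + 1))

/-! ### Submanifolds -/

/-- An immersion `F` of a manifold of dimension `n + 1` in `K(N)` is special Lagrangian for `ω_u` and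
`φ` if `ω_u` and `Im φ` vanish on its tangent spaces. -/
structure IsSpecialLagrangian (g : RMetric n N) (t : ℝ) (u : ℝ → ℝ) {V H P : Type*}
    [NormedAddCommGroup V] [NormedSpace ℝ V] [TopologicalSpace H] (I : ModelWithCorners ℝ V H)
    [TopologicalSpace P] [ChartedSpace H P] (F : P → CanonicalBundle n N) : Prop where
  dim : Module.finrank ℝ V = n + 1
  smooth : ContMDiff I (modelK n) ∞ F
  immersion : ∀ q, Function.Injective (mfderiv I (modelK n) F q)
  lagrangian : ∀ (q : P) (v w : TangentSpace I q),
    calabiForm g t u (F q) (mfderiv I (modelK n) F q v) (mfderiv I (modelK n) F q w) = 0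
  special : ∀ (q : P) (v : Fin (n + 1) → TangentSpace I q),
    (holVolumeForm (F q) fun i => mfderiv I (modelK n) F q (v i)).im = 0

section Lagrangian

variable {L : Type*} [TopologicalSpace L] [ChartedSpace (EuclideanSpace ℝ (Fin n)) L]

/-- The differential of `ι` at `l`. -/
def tmap (ι : L → N) (l : L) : TangentSpace (𝓡 n) l →L[ℝ] Cn n :=
  mfderiv (𝓡 n) 𝓘(ℝ, Cn n) ι l

/-- `ι : L → N` is a Lagrangian immersion of the `n`-manifold `L`. -/
structure IsLagrangian (g : RMetric n N) (ι : L → N) : Prop where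
  smooth : ContMDiff (𝓡 n) 𝓘(ℝ, Cn n) ∞ ι
  immersion : ∀ l : L, Function.Injective (tmap (n := n) ι l)
  lagrangian : ∀ (l : L) (v w : TangentSpace (𝓡 n) l),
    kahlerForm g (ι l) (tmap ι l v) (tmap ι l w) = 0

/-- The frame `v` of `T_lL` is orthonormal for the induced metric `ι^*g`. -/
def IsOrthonormalFrame (g : RMetric n N) (ι : L → N) (l : L)
    (v : Module.Basis (Fin n) ℝ (TangentSpace (𝓡 n) l)) : Prop :=
  ∀ i j, inn g (ι l) (tmap ι l (v i)) (tmap ι l (v j)) = if i = j then 1 else 0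

/-- The covariant derivative `∇_v (ι_* w)` along `ι` at `l`, for `w` extended to a vector field that is
constant in the preferred chart at `l`. -/
def covDerivAlong (g : RMetric n N) (ι : L → N) (l : L) (v w : TangentSpace (𝓡 n) l) : Cn n :=
  fderiv ℝ (fderiv ℝ (writtenInExtChartAt (𝓡 n) 𝓘(ℝ, Cn n) l ι)) (extChartAt (𝓡 n) l l) v w
    + Gam g (ι l) (tmap ι l v) (tmap ι l w)

/-- `ι` is minimal: the trace of the second fundamental form, the normal part of `∇_v (ι_* w)`,
vanishes. -/
def IsMinimal (g : RMetric n N) (ι : L → N) : Prop :=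
  ∀ (l : L) (v : Module.Basis (Fin n) ℝ (TangentSpace (𝓡 n) l)), IsOrthonormalFrame g ι l v →
    ∀ ν : Cn n, (∀ w, inn g (ι l) ν (tmap ι l w) = 0) →
      inn g (ι l) (∑ j, covDerivAlong g ι l (v j) (v j)) ν = 0

/-- The orientation `o` of the tangent spaces of `L` is continuous: it is locally constant in the
local trivializations of the tangent bundle. -/
def IsOrientation [IsManifold (𝓡 n) ∞ L]
    (o : ∀ l : L, Orientation ℝ (TangentSpace (𝓡 n) l) (Fin n)) : Prop :=
  ∀ l₀ : L, ∃ o₀ : Orientation ℝ (EuclideanSpace ℝ (Fin n)) (Fin n), ∀ᶠ l in 𝓝 l₀,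
    ∀ h : l ∈ (trivializationAt (EuclideanSpace ℝ (Fin n)) (TangentSpace (𝓡 n)) l₀).baseSet,
      Orientation.map (Fin n) ((trivializationAt (EuclideanSpace ℝ (Fin n))
        (TangentSpace (𝓡 n)) l₀).continuousLinearEquivAt ℝ l h).toLinearEquiv (o l) = o₀

/-- The element `a` of `K_{ι(l)}` restricts to the volume form of `L` at `l`, the form which is `1` on
positively and `-1` on negatively oriented orthonormal frames. -/
def RestrictsToVolume (g : RMetric n N) (ι : L → N)
    (o : ∀ l : L, Orientation ℝ (TangentSpace (𝓡 n) l) (Fin n)) (l : L)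
    (a : CanonicalFiber n N (ι l)) : Prop :=
  ∀ v : Module.Basis (Fin n) ℝ (TangentSpace (𝓡 n) l), IsOrthonormalFrame g ι l v →
    (v.orientation = o l → fiberForm (ι l) a (fun i => tmap ι l (v i)) = 1) ∧
    (v.orientation ≠ o l → fiberForm (ι l) a (fun i => tmap ι l (v i)) = -1)

/-- The submanifold `L^K = {a κ_l | l ∈ L, a ∈ ℝ}` of `K(N)`, as the image of `L × ℝ`. -/
def coneMap (ι : L → N) (κ : ∀ l, CanonicalFiber n N (ι l)) (q : L × ℝ) : CanonicalBundle n N :=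
  ⟨ι q.1, (q.2 : ℂ) • κ q.1⟩

end Lagrangian

end

end MinLag

open MinLag

namespace MinLag

noncomputable section

open Module Function

/-! ### Linear algebra of Lagrangian subspaces -/

section LinearAlgebra

variable {n : ℕ}

/-! Along `L` write `∇κ = α ⊗ κ`. If `κ = f dz₁ ∧ … ∧ dzₙ` in a holomorphic chart and `ψ` is the
connection form, then `α = df/f + ψ(ι_* ·)`; this is `connCoeff`. Both conditions of the theorem
turn out to say that `α` is real.

Minimality. A Lagrangian tangent space is totally real, so a real frame of it is a complex basis of
`ℂⁿ` and `κ` is determined by its value there. The function `f dz(ι_* v₁, …, ι_* vₙ)` is real, and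
its derivative along `u` is computed with two facts: `ψ(w)` is minus the complex trace of `Γ(w, ·)`,
which is complex linear because the metric is Kähler, and the cubic form `g(∇_u ι_* v, J ι_* w)` is
totally symmetric (`covDeriv_symm`, `inner_covDeriv_comm`). The outcome is `Im α(u) = -g(H, J ι_*
u)`, with `H` the trace of `∇ι_*` (`im_connection`, `im_connCoeff`). Since `J` maps the tangent
space onto the normal space, `H` has no normal part exactly if `Im α = 0` (`isMinimal_iff`).

The cone. At `aκ_l` the vertical part of the differential of `coneMap` on `(u, s)` is `(s + a α(u))
κ_l`. The horizontal part of `ω_u` vanishes because `L` is Lagrangian, and the vertical part is a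
nonzero multiple of `Im ((s + a α(u)) conj(s' + a α(u')))` (`calabiForm_coneMap`). It vanishes for
real `α`; conversely the vectors `(0, 1)` and `(u, 0)` at `a = 1` recover `Im α(u)`. The condition
on `Im φ` always holds: `φ = dy ∧ dz₁ ∧ … ∧ dzₙ` and `y = a f` pull it back to `da ∧ f dz|_L`, which
is real, because `df ∧ dz|_L` has degree `n + 1` on an `n`-manifold (`im_holVolumeForm_coneMap`).

Smoothness of `κ` comes from `f = ± √(det Gram) / dz(ι_* v₁, …, ι_* vₙ)` with a locally constant
sign. -/

theorem dzForm_apply (v : Fin n → Cn n) :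
    dzForm n v = (EuclideanSpace.basisFun (Fin n) ℂ).toBasis.det v := rfl

theorem dzForm_single : dzForm n (fun i => EuclideanSpace.single i (1 : ℂ)) = 1 := by
  rw [dzForm_apply]
  convert (EuclideanSpace.basisFun (Fin n) ℂ).toBasis.det_self using 2
  ext i : 1
  simp

theorem dzForm_map (T : Cn n →ₗ[ℂ] Cn n) (v : Fin n → Cn n) :
    dzForm n (fun i => T (v i)) = LinearMap.det T * dzForm n v := by
  simp only [dzForm_apply]
  exact Basis.det_comp _ T v

theorem dzForm_basis_ne_zero (b : Basis (Fin n) ℂ (Cn n)) : dzForm n b ≠ 0 :=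
  (Basis.isUnit_det _ b).ne_zero

theorem dzForm_eq_mul_det (b : Basis (Fin n) ℂ (Cn n)) (v : Fin n → Cn n) :
    dzForm n v = dzForm n b * b.det v := by
  have h := AlternatingMap.eq_smul_basis_det b (EuclideanSpace.basisFun (Fin n) ℂ).toBasis.det
  simp only [dzForm_apply]
  conv_lhs => rw [h]
  rfl

/-- Cramer's rule for the identity matrix: all coordinates of `x` other than the `j`-th are killed
by the remaining basis vectors. -/
theorem dzForm_update (b : Basis (Fin n) ℂ (Cn n)) (j : Fin n) (x : Cn n) :
    dzForm n (update b j x) = dzForm n b * b.repr x j := by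
  rw [dzForm_eq_mul_det b, Basis.det_apply, Basis.toMatrix_update, Basis.toMatrix_self]
  congr 1
  rw [← Matrix.cramer_apply, Matrix.cramer_one, Module.End.one_apply]

/-- Jacobi's formula: the derivation extending a complex linear map `T` acts on `dz₁ ∧ … ∧ dzₙ` by
the trace of `T`. -/
theorem sum_dzForm_update_map (b : Basis (Fin n) ℂ (Cn n)) (T : Cn n →ₗ[ℂ] Cn n) :
    ∑ j, dzForm n (update b j (T (b j))) = dzForm n b * LinearMap.trace ℂ _ T := by
  simp only [dzForm_update, LinearMap.trace_eq_matrix_trace ℂ b, Matrix.trace, Matrix.diag_apply,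
    LinearMap.toMatrix_apply, Finset.mul_sum]

/-- A positive definite inner product on `ℂⁿ` for which multiplication by `i` is an isometry. -/
structure IsHermitianInner (B : Cn n →L[ℝ] Cn n →L[ℝ] ℝ) : Prop where
  symm : ∀ v w, B v w = B w v
  pos : ∀ v, v ≠ 0 → 0 < B v v
  herm : ∀ v w, B (Complex.I • v) (Complex.I • w) = B v w

variable {B : Cn n →L[ℝ] Cn n →L[ℝ] ℝ} {V : Type*} [AddCommGroup V] [Module ℝ V]

theorem IsHermitianInner.I_smul_left (hB : IsHermitianInner B) (v w : Cn n) :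
    B (Complex.I • v) w = - B v (Complex.I • w) := by
  have h := hB.herm v (Complex.I • w)
  rw [smul_smul, Complex.I_mul_I, neg_smul, one_smul, map_neg] at h
  linarith

/-- An injective linear map whose image is isotropic for the Kähler form of `B`. -/
structure IsLagrangianMap (B : Cn n →L[ℝ] Cn n →L[ℝ] ℝ) (τ : V →ₗ[ℝ] Cn n) : Prop where
  injective : Injective τ
  isotropic : ∀ v w, B (Complex.I • τ v) (τ w) = 0

theorem smul_eq_re_add_im (c : ℂ) (x : Cn n) : c • x = c.re • x + c.im • Complex.I • x := by
  conv_lhs => rw [← Complex.re_add_im c]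
  rw [add_smul, mul_smul, Complex.coe_smul, Complex.coe_smul]

theorem bilin_complex_smul_left (B : Cn n →L[ℝ] Cn n →L[ℝ] ℝ) (c : ℂ) (x y : Cn n) :
    B (c • x) y = c.re * B x y + c.im * B (Complex.I • x) y := by
  rw [smul_eq_re_add_im c x]
  simp

theorem IsLagrangianMap.isotropic_right {τ : V →ₗ[ℝ] Cn n} (hB : IsHermitianInner B)
    (hτ : IsLagrangianMap B τ) (v w : V) : B (τ v) (Complex.I • τ w) = 0 := by
  rw [hB.symm, hτ.isotropic]

/-- Splitting the coefficients of a complex relation into real and imaginary parts gives `τ X + i τ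
Y = 0`. The two terms are orthogonal for `B`, so both vanish. -/
theorem IsLagrangianMap.linearIndependent {τ : V →ₗ[ℝ] Cn n} (hB : IsHermitianInner B)
    (hτ : IsLagrangianMap B τ) (v : Basis (Fin n) ℝ V) :
    LinearIndependent ℂ fun i => τ (v i) := by
  rw [Fintype.linearIndependent_iff]
  intro c hc
  set X : V := ∑ i, (c i).re • v i with hX
  set Y : V := ∑ i, (c i).im • v i with hY
  have hXY : τ X + Complex.I • τ Y = 0 := by
    rw [← hc, hX, hY, map_sum, map_sum, Finset.smul_sum, ← Finset.sum_add_distrib]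
    refine Finset.sum_congr rfl fun i _ => ?_
    rw [smul_eq_re_add_im (c i), map_smul, map_smul, smul_comm Complex.I]
  have hX0 : τ X = 0 := by
    by_contra h
    have h1 := hB.pos _ h
    have h2 : B (τ X + Complex.I • τ Y) (τ X) = 0 := by rw [hXY]; simp
    rw [map_add, add_apply, hτ.isotropic] at h2
    linarith
  have hY0 : τ Y = 0 := by
    rw [hX0, zero_add] at hXY
    exact (smul_eq_zero.1 hXY).resolve_left Complex.I_ne_zero
  have hX1 := Fintype.linearIndependent_iff.1 v.linearIndependent _
    (hτ.injective (hX0.trans (map_zero τ).symm))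
  have hY1 := Fintype.linearIndependent_iff.1 v.linearIndependent _
    (hτ.injective (hY0.trans (map_zero τ).symm))
  exact fun i => Complex.ext (hX1 i) (hY1 i)

/-- The complex basis of `ℂⁿ` given by the image of a real basis under a Lagrangian map. -/
def IsLagrangianMap.basis {τ : V →ₗ[ℝ] Cn n} (hB : IsHermitianInner B)
    (hτ : IsLagrangianMap B τ) (v : Basis (Fin n) ℝ V) : Basis (Fin n) ℂ (Cn n) :=
  Basis.mk (hτ.linearIndependent hB v)
    ((hτ.linearIndependent hB v).span_eq_top_of_card_eq_finrank' (by simp)).ge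

@[simp]
theorem IsLagrangianMap.coe_basis {τ : V →ₗ[ℝ] Cn n} (hB : IsHermitianInner B)
    (hτ : IsLagrangianMap B τ) (v : Basis (Fin n) ℝ V) :
    ⇑(hτ.basis hB v) = fun i => τ (v i) :=
  Basis.coe_mk _ _

theorem IsLagrangianMap.dzForm_ne_zero {τ : V →ₗ[ℝ] Cn n} (hB : IsHermitianInner B)
    (hτ : IsLagrangianMap B τ) (v : Basis (Fin n) ℝ V) : dzForm n (fun i => τ (v i)) ≠ 0 := by
  rw [← hτ.coe_basis hB v]
  exact dzForm_basis_ne_zero _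

/-- The real and the imaginary part of the pullback are real forms of top degree on `V`, hence
multiples of `v.det`. -/
theorem dzForm_real_basis (τ : V →ₗ[ℝ] Cn n) (v : Basis (Fin n) ℝ V) (w : Fin n → V) :
    dzForm n (fun i => τ (w i)) = (v.det w : ℂ) * dzForm n (fun i => τ (v i)) := by
  let f : V [⋀^Fin n]→ₗ[ℝ] ℂ := (dzForm n).toAlternatingMap.compLinearMap τ
  have hr := congrArg (fun φ : V [⋀^Fin n]→ₗ[ℝ] ℝ => φ w)
    (AlternatingMap.eq_smul_basis_det v (Complex.reLm.compAlternatingMap f))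
  have hi := congrArg (fun φ : V [⋀^Fin n]→ₗ[ℝ] ℝ => φ w)
    (AlternatingMap.eq_smul_basis_det v (Complex.imLm.compAlternatingMap f))
  have hr' : (f w).re = (f v).re * v.det w := hr
  have hi' : (f w).im = (f v).im * v.det w := hi
  change f w = (v.det w : ℂ) * f v
  apply Complex.ext <;> simp [hr', hi', mul_comm]

/-- `v` is orthonormal for the pullback of `B` by `τ`. -/
def IsOrthonormalFor (B : Cn n →L[ℝ] Cn n →L[ℝ] ℝ) (τ : V →ₗ[ℝ] Cn n)
    (v : Basis (Fin n) ℝ V) : Prop :=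
  ∀ i j, B (τ (v i)) (τ (v j)) = if i = j then 1 else 0

/-- The vectors `τ (v j)` and `i τ (v j)` together form a real orthonormal basis of `ℂⁿ`, so real
and imaginary parts of complex coordinates are inner products with them. -/
theorem IsLagrangianMap.repr_re {τ : V →ₗ[ℝ] Cn n} (hB : IsHermitianInner B)
    (hτ : IsLagrangianMap B τ) {v : Basis (Fin n) ℝ V} (hv : IsOrthonormalFor B τ v)
    (x : Cn n) (j : Fin n) : ((hτ.basis hB v).repr x j).re = B x (τ (v j)) := by
  conv_rhs => rw [← (hτ.basis hB v).sum_repr x]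
  simp only [map_sum, sum_apply, hτ.coe_basis, bilin_complex_smul_left, hτ.isotropic, hv _ j]
  simp

theorem IsLagrangianMap.repr_im {τ : V →ₗ[ℝ] Cn n} (hB : IsHermitianInner B)
    (hτ : IsLagrangianMap B τ) {v : Basis (Fin n) ℝ V} (hv : IsOrthonormalFor B τ v)
    (x : Cn n) (j : Fin n) :
    ((hτ.basis hB v).repr x j).im = B x (Complex.I • τ (v j)) := by
  conv_rhs => rw [← (hτ.basis hB v).sum_repr x]
  simp only [map_sum, sum_apply, hτ.coe_basis, bilin_complex_smul_left, hτ.isotropic_right hB, hB.herm,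
    hv _ j]
  simp

/-- For a normal vector the real parts of the coordinates in the complex basis vanish; what is left
is `i` times a tangent vector. -/
theorem IsLagrangianMap.exists_of_normal {τ : V →ₗ[ℝ] Cn n} (hB : IsHermitianInner B)
    (hτ : IsLagrangianMap B τ) {v : Basis (Fin n) ℝ V} (hv : IsOrthonormalFor B τ v)
    {ν : Cn n} (hν : ∀ w, B ν (τ w) = 0) : ∃ u, ν = Complex.I • τ u := by
  refine ⟨∑ j, ((hτ.basis hB v).repr ν j).im • v j, ?_⟩
  conv_lhs => rw [← (hτ.basis hB v).sum_repr ν]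
  rw [map_sum, Finset.smul_sum]
  refine Finset.sum_congr rfl fun j _ => ?_
  rw [smul_eq_re_add_im, hτ.repr_re hB hv, hν, hτ.coe_basis, map_smul, smul_comm Complex.I]
  simp

/-- The pullback of `B` by `τ`. -/
def pullbackForm (B : Cn n →L[ℝ] Cn n →L[ℝ] ℝ) (τ : V →ₗ[ℝ] Cn n) : LinearMap.BilinForm ℝ V :=
  LinearMap.mk₂ ℝ (fun v w => B (τ v) (τ w)) (by simp) (by simp) (by simp) (by simp)

@[simp]
theorem pullbackForm_apply (B : Cn n →L[ℝ] Cn n →L[ℝ] ℝ) (τ : V →ₗ[ℝ] Cn n) (v w : V) :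
    pullbackForm B τ v w = B (τ v) (τ w) := rfl

theorem IsHermitianInner.exists_orthonormal (hB : IsHermitianInner B) {τ : V →ₗ[ℝ] Cn n}
    (hτ : Injective τ) (w : Basis (Fin n) ℝ V) : ∃ v, IsOrthonormalFor B τ v := by
  have : FiniteDimensional ℝ V := w.finiteDimensional_of_finite
  have hs : LinearMap.IsSymm (pullbackForm B τ) := ⟨fun v w => hB.symm _ _⟩
  obtain ⟨v₀, hv₀⟩ := LinearMap.BilinForm.exists_orthogonal_basis hs
  have hd : finrank ℝ V = n := by simpa using finrank_eq_card_basis w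
  let v₁ := v₀.reindex (finCongr hd)
  have hpos : ∀ i, 0 < B (τ (v₁ i)) (τ (v₁ i)) := fun i =>
    hB.pos _ fun h => v₁.ne_zero i (hτ (h.trans (map_zero τ).symm))
  have hu : ∀ i, IsUnit (Real.sqrt (B (τ (v₁ i)) (τ (v₁ i))))⁻¹ := fun i =>
    (inv_ne_zero (Real.sqrt_pos.2 (hpos i)).ne').isUnit
  refine ⟨v₁.isUnitSMul hu, fun i j => ?_⟩
  simp only [Basis.isUnitSMul_apply, map_smul, smul_apply, smul_eq_mul]
  split_ifs with hij
  · subst hij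
    have h := Real.mul_self_sqrt (hpos i).le
    have h' := (Real.sqrt_pos.2 (hpos i)).ne'
    field_simp
    nlinarith
  · have : B (τ (v₁ i)) (τ (v₁ j)) = 0 := by
      have h := hv₀ (i := (finCongr hd).symm i) (j := (finCongr hd).symm j) (by simpa using hij)
      simpa [v₁, Function.onFun] using h
    rw [this]; ring

/-- The Gram matrix of a family of vectors for the pullback of `B` by `τ`. -/
def gram (B : Cn n →L[ℝ] Cn n →L[ℝ] ℝ) (τ : V →ₗ[ℝ] Cn n) (w : Fin n → V) :
    Matrix (Fin n) (Fin n) ℝ :=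
  Matrix.of fun i j => B (τ (w i)) (τ (w j))

theorem det_gram {τ : V →ₗ[ℝ] Cn n} {v : Basis (Fin n) ℝ V} (hv : IsOrthonormalFor B τ v)
    (w : Basis (Fin n) ℝ V) : (gram B τ w).det = v.det w ^ 2 := by
  have h := LinearMap.BilinForm.toMatrix_mul_basis_toMatrix v w (pullbackForm B τ)
  have h1 : (LinearMap.BilinForm.toMatrix v) (pullbackForm B τ) = 1 := by
    ext i j
    simpa [LinearMap.BilinForm.toMatrix_apply, Matrix.one_apply] using hv i j
  have h2 : (LinearMap.BilinForm.toMatrix w) (pullbackForm B τ) = gram B τ w := by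
    ext i j
    simp [LinearMap.BilinForm.toMatrix_apply, gram]
  rw [← h2, ← h, h1, mul_one, Matrix.det_mul, Matrix.det_transpose, Basis.det_apply, sq]

theorem det_gram_orthonormal {τ : V →ₗ[ℝ] Cn n} {v : Basis (Fin n) ℝ V}
    (hv : IsOrthonormalFor B τ v) : (gram B τ v).det = 1 := by
  rw [det_gram hv, Basis.det_self, one_pow]

theorem det_gram_pos (hB : IsHermitianInner B) {τ : V →ₗ[ℝ] Cn n} (hτ : Injective τ)
    (w : Basis (Fin n) ℝ V) : 0 < (gram B τ w).det := by
  obtain ⟨v, hv⟩ := hB.exists_orthonormal hτ w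
  rw [det_gram hv]
  have := (v.isUnit_det w).ne_zero
  positivity

open scoped Classical in
/-- The sign of a basis with respect to an orientation. -/
def orientSign (o : Orientation ℝ V (Fin n)) (v : Basis (Fin n) ℝ V) : ℝ :=
  if v.orientation = o then 1 else -1

theorem orientSign_ne_zero (o : Orientation ℝ V (Fin n)) (v : Basis (Fin n) ℝ V) :
    orientSign o v ≠ 0 := by
  unfold orientSign
  split_ifs <;> norm_num

/-- The sign of `v.det w` tells whether `v` and `w` have the same orientation. This makes the volume
form consistent under a change of frame. -/
theorem orientSign_mul_abs_det (o : Orientation ℝ V (Fin n)) (v w : Basis (Fin n) ℝ V) :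
    orientSign o w * |v.det w| = orientSign o v * v.det w := by
  have hne := (v.isUnit_det w).ne_zero
  have key := v.orientation_eq_iff_det_pos w
  have hneg : w.orientation = o ∨ w.orientation = -o := by
    rcases w.orientation_eq_or_eq_neg o with h | h <;> simp [h]
  have hneg' : v.orientation = o ∨ v.orientation = -o := by
    rcases v.orientation_eq_or_eq_neg o with h | h <;> simp [h]
  have ho : -o ≠ o := (Module.Ray.ne_neg_self o).symm
  unfold orientSign
  rcases hneg with h | h <;> rcases hneg' with h' | h' <;> rw [h, h'] at key
  · simp [h, h', abs_of_pos (key.1 rfl)]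
  · have : ¬ 0 < v.det w := fun hp => ho (key.2 hp)
    rw [h, h', if_pos rfl, if_neg ho, abs_of_nonpos (not_lt.1 this)]; ring
  · have : ¬ 0 < v.det w := fun hp => ho (key.2 hp).symm
    rw [h, h', if_pos rfl, if_neg ho, abs_of_nonpos (not_lt.1 this)]; ring
  · rw [h, h', if_neg ho, abs_of_pos (key.1 rfl)]

/-- The coefficient of the element of the canonical line that restricts to the volume form of a
Lagrangian map. -/
theorem IsLagrangianMap.exists_volume {τ : V →ₗ[ℝ] Cn n} (hB : IsHermitianInner B)
    (hτ : IsLagrangianMap B τ) (o : Orientation ℝ V (Fin n)) (e : Basis (Fin n) ℝ V) :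
    ∃ a : ℂ, ∀ w : Basis (Fin n) ℝ V,
      a * dzForm n (fun i => τ (w i)) = (orientSign o w * Real.sqrt (gram B τ w).det : ℝ) := by
  obtain ⟨v, hv⟩ := hB.exists_orthonormal hτ.injective e
  -- The value on one orthonormal frame `v` forces this coefficient. For any other frame both sides
  -- pick up the factor `v.det w`, since the Gram determinant is its square.
  refine ⟨orientSign o v / dzForm n (fun i => τ (v i)), fun w => ?_⟩
  rw [det_gram hv, Real.sqrt_sq_eq_abs, orientSign_mul_abs_det, dzForm_real_basis τ v w]
  have := hτ.dzForm_ne_zero hB v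
  push_cast
  field_simp

end LinearAlgebra

/-! ### The Levi-Civita connection of a Kähler metric in holomorphic coordinates -/

section Christoffel

variable {n : ℕ} {G : Cn n → Cn n →L[ℝ] Cn n →L[ℝ] ℝ} {z : Cn n}

theorem fderiv_apply_apply (hd : DifferentiableAt ℝ G z) (u v w : Cn n) :
    fderiv ℝ (fun z' => G z' v w) z u = fderiv ℝ G z u v w := by
  have h := ((hd.hasFDerivAt.clm_apply (hasFDerivAt_const v z)).clm_apply
    (hasFDerivAt_const w z)).fderiv
  rw [h]
  simp

theorem fderiv_metric_symm (hd : DifferentiableAt ℝ G z)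
    (hG : ∀ᶠ z' in 𝓝 z, IsHermitianInner (G z')) (u v w : Cn n) :
    fderiv ℝ G z u v w = fderiv ℝ G z u w v := by
  rw [← fderiv_apply_apply hd, ← fderiv_apply_apply hd]
  have : (fun z' => G z' v w) =ᶠ[𝓝 z] fun z' => G z' w v := by
    filter_upwards [hG] with z' h using h.symm v w
  rw [this.fderiv_eq]

theorem fderiv_metric_herm (hd : DifferentiableAt ℝ G z)
    (hG : ∀ᶠ z' in 𝓝 z, IsHermitianInner (G z')) (u v w : Cn n) :
    fderiv ℝ G z u (Complex.I • v) w = - fderiv ℝ G z u v (Complex.I • w) := by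
  rw [← fderiv_apply_apply hd, ← fderiv_apply_apply hd]
  have : (fun z' => G z' (Complex.I • v) w) =ᶠ[𝓝 z] fun z' => - G z' v (Complex.I • w) := by
    filter_upwards [hG] with z' h using h.I_smul_left v w
  rw [this.fderiv_eq, fderiv_fun_neg]
  rfl

/-- Needed for `christoffel` to be meaningful: `ContinuousLinearMap.inverse` is `0` on maps that are
not invertible. -/
theorem IsHermitianInner.isInvertible {B : Cn n →L[ℝ] Cn n →L[ℝ] ℝ} (hB : IsHermitianInner B) :
    B.IsInvertible := by
  have hinj : Injective (B : Cn n →ₗ[ℝ] (Cn n →L[ℝ] ℝ)) := by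
    rw [injective_iff_map_eq_zero]
    intro v hv
    by_contra h
    have h1 := hB.pos v h
    have h2 : B v = 0 := hv
    rw [h2] at h1
    simp at h1
  have hfin : finrank ℝ (Cn n) = finrank ℝ (Cn n →L[ℝ] ℝ) := by
    rw [← (LinearMap.toContinuousLinearMap (𝕜 := ℝ) (E := Cn n) (F' := ℝ)).finrank_eq]
    exact Subspace.dual_finrank_eq.symm
  exact ⟨(LinearEquiv.ofInjectiveOfFinrankEq _ hinj hfin).toContinuousLinearEquiv, by ext; rfl⟩

theorem IsHermitianInner.ext {B : Cn n →L[ℝ] Cn n →L[ℝ] ℝ} (hB : IsHermitianInner B) {v w : Cn n}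
    (h : ∀ y, B v y = B w y) : v = w := by
  by_contra hne
  have h1 := hB.pos (v - w) (sub_ne_zero.2 hne)
  rw [map_sub B, sub_apply, h, sub_self] at h1
  exact lt_irrefl _ h1

theorem inner_christoffel (hB : IsHermitianInner (G z)) (v w y : Cn n) :
    G z (christoffel G z v w) y =
      2⁻¹ * (fderiv ℝ G z v w y + fderiv ℝ G z w v y - fderiv ℝ G z y v w) := by
  have h : G z (christoffel G z v w) = christoffelFirst G z v w :=
    hB.isInvertible.self_apply_inverse _
  rw [h]
  simp [christoffelFirst]

variable (hd : DifferentiableAt ℝ G z) (hG : ∀ᶠ z' in 𝓝 z, IsHermitianInner (G z'))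
include hd hG

theorem christoffel_symm (v w : Cn n) : christoffel G z v w = christoffel G z w v := by
  refine hG.self_of_nhds.ext fun y => ?_
  rw [inner_christoffel hG.self_of_nhds, inner_christoffel hG.self_of_nhds,
    fderiv_metric_symm hd hG y v w]
  ring

/-- Compatibility of the Levi-Civita connection with the metric, in coordinates. -/
theorem fderiv_metric_eq_christoffel (u v w : Cn n) :
    fderiv ℝ G z u v w = G z (christoffel G z u v) w + G z v (christoffel G z u w) := by
  rw [hG.self_of_nhds.symm v, inner_christoffel hG.self_of_nhds,
    inner_christoffel hG.self_of_nhds, fderiv_metric_symm hd hG u w v,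
    fderiv_metric_symm hd hG v u w, fderiv_metric_symm hd hG w u v]
  ring

/-- `∇J = 0` for a Kähler metric; `J` is constant in the coordinates, so this is complex linearity
of `Γ(v, ·)`. -/
theorem christoffel_I_smul
    (hclosed : ∀ u v w, fderiv ℝ G z u (Complex.I • v) w + fderiv ℝ G z v (Complex.I • w) u
      + fderiv ℝ G z w (Complex.I • u) v = 0) (v w : Cn n) :
    christoffel G z v (Complex.I • w) = Complex.I • christoffel G z v w := by
  refine hG.self_of_nhds.ext fun y => ?_
  rw [hG.self_of_nhds.I_smul_left, inner_christoffel hG.self_of_nhds,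
    inner_christoffel hG.self_of_nhds]
  -- By the Koszul formula `2 g((∇_v J)w, y)` is the difference of the cyclic sums in `dω = 0` at
  -- `(v, w, y)` and at `(v, iw, iy)`, up to the symmetries `h3`–`h7` of the derivative of the
  -- metric.
  have h1 := hclosed v w y
  have h2 := hclosed v (Complex.I • w) (Complex.I • y)
  rw [smul_smul, smul_smul, Complex.I_mul_I, neg_smul, one_smul, neg_smul, one_smul] at h2
  simp only [map_neg, neg_apply] at h2
  have h3 := fderiv_metric_herm hd hG v w y
  have h4 := fderiv_metric_herm hd hG y v w
  have h5 := fderiv_metric_herm hd hG (Complex.I • y) v (Complex.I • w)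
  rw [smul_smul, Complex.I_mul_I, neg_smul, one_smul, map_neg] at h5
  have h6 := fderiv_metric_symm hd hG w (Complex.I • y) v
  have h7 := fderiv_metric_symm hd hG (Complex.I • w) y v
  linarith

end Christoffel

/-! ### Lagrangian immersions in holomorphic coordinates -/

section LocalLagrangian

variable {n : ℕ} {E : Type*} [NormedAddCommGroup E] [NormedSpace ℝ E]

/-- The covariant derivative of the coordinate vector fields along `ζ`. -/
def covDeriv (G : Cn n → Cn n →L[ℝ] Cn n →L[ℝ] ℝ) (ζ : E → Cn n) (x : E) (v w : E) : Cn n :=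
  fderiv ℝ (fderiv ℝ ζ) x v w + christoffel G (ζ x) (fderiv ℝ ζ x v) (fderiv ℝ ζ x w)

/-- The data of a Lagrangian immersion `ζ` near `x` into `ℂⁿ` with a Kähler metric `G`. -/
structure IsLocalLagrangian (G : Cn n → Cn n →L[ℝ] Cn n →L[ℝ] ℝ) (ζ : E → Cn n) (x : E) :
    Prop where
  contDiff_metric : ContDiffAt ℝ ∞ G (ζ x)
  hermitian : ∀ᶠ z in 𝓝 (ζ x), IsHermitianInner (G z)
  closed : ∀ u v w, fderiv ℝ G (ζ x) u (Complex.I • v) w + fderiv ℝ G (ζ x) v (Complex.I • w) u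
      + fderiv ℝ G (ζ x) w (Complex.I • u) v = 0
  contDiff : ContDiffAt ℝ ∞ ζ x
  lagrangian : ∀ᶠ y in 𝓝 x, IsLagrangianMap (G (ζ y)) (fderiv ℝ ζ y : E →ₗ[ℝ] Cn n)

variable {G : Cn n → Cn n →L[ℝ] Cn n →L[ℝ] ℝ} {ζ : E → Cn n} {x : E}

namespace IsLocalLagrangian

variable (h : IsLocalLagrangian G ζ x)
include h

theorem differentiableAt_metric : DifferentiableAt ℝ G (ζ x) :=
  h.contDiff_metric.differentiableAt (by simp)

theorem differentiableAt : DifferentiableAt ℝ ζ x := h.contDiff.differentiableAt (by simp)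

theorem contDiffAt_fderiv : ContDiffAt ℝ ∞ (fderiv ℝ ζ) x :=
  h.contDiff.fderiv_right (by simp)

theorem differentiableAt_fderiv : DifferentiableAt ℝ (fderiv ℝ ζ) x :=
  h.contDiffAt_fderiv.differentiableAt (by simp)

theorem hasFDerivAt_fderiv_apply (v : E) :
    HasFDerivAt (fun y => fderiv ℝ ζ y v) ((fderiv ℝ (fderiv ℝ ζ) x).flip v) x := by
  have := h.differentiableAt_fderiv.hasFDerivAt.clm_apply (hasFDerivAt_const v x)
  rwa [ContinuousLinearMap.comp_zero, zero_add] at this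

/-- The connection has no torsion and second derivatives commute. -/
theorem covDeriv_symm (v w : E) : covDeriv G ζ x v w = covDeriv G ζ x w v := by
  have h2 : IsSymmSndFDerivAt ℝ ζ x := h.contDiff.isSymmSndFDerivAt (by
    rw [minSmoothness_of_isRCLikeNormedField]
    exact WithTop.coe_le_coe.2 le_top)
  rw [covDeriv, covDeriv, h2.eq, christoffel_symm h.differentiableAt_metric h.hermitian]

/-- Differentiating the isotropy relation `g(J ζ_* v, ζ_* w) = 0` along `u`, with `∇g = 0` and `∇J =
0`. Together with `covDeriv_symm` this is the total symmetry of the second fundamental form of a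
Lagrangian. -/
theorem inner_covDeriv_comm (u v w : E) :
    G (ζ x) (covDeriv G ζ x u v) (Complex.I • fderiv ℝ ζ x w) =
      G (ζ x) (covDeriv G ζ x u w) (Complex.I • fderiv ℝ ζ x v) := by
  have hB := h.hermitian.self_of_nhds
  have hGd : HasFDerivAt (fun y => G (ζ y)) ((fderiv ℝ G (ζ x)).comp (fderiv ℝ ζ x)) x :=
    h.differentiableAt_metric.hasFDerivAt.comp x h.differentiableAt.hasFDerivAt
  have hE : ∀ v, HasFDerivAt (fun y => fderiv ℝ ζ y v)
      ((fderiv ℝ (fderiv ℝ ζ) x).flip v) x := h.hasFDerivAt_fderiv_apply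
  have hI : HasFDerivAt (fun y => Complex.I • fderiv ℝ ζ y v)
      (Complex.I • (fderiv ℝ (fderiv ℝ ζ) x).flip v) x := (hE v).const_smul Complex.I
  have hF := (hGd.clm_apply hI).clm_apply (hE w)
  have h0 : (fun y => G (ζ y) (Complex.I • fderiv ℝ ζ y v) (fderiv ℝ ζ y w)) =ᶠ[𝓝 x]
      fun _ => 0 := by
    filter_upwards [h.lagrangian] with y hy using hy.isotropic v w
  have h1 := hF.fderiv
  rw [h0.fderiv_eq, fderiv_fun_const] at h1
  have h2 := congrArg (fun φ : E →L[ℝ] ℝ => φ u) h1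
  simp only [add_apply, ContinuousLinearMap.comp_apply,
    ContinuousLinearMap.flip_apply, smul_apply, Pi.zero_apply, zero_apply] at h2
  rw [fderiv_metric_eq_christoffel h.differentiableAt_metric h.hermitian,
    christoffel_I_smul h.differentiableAt_metric h.hermitian h.closed, hB.I_smul_left,
    hB.I_smul_left, hB.I_smul_left, hB.I_smul_left] at h2
  simp only [covDeriv, map_add, add_apply]
  have h3 := hB.I_smul_left (fderiv ℝ ζ x v) (fderiv ℝ (fderiv ℝ ζ) x u w)
  have h4 := hB.I_smul_left (fderiv ℝ ζ x v) (christoffel G (ζ x) (fderiv ℝ ζ x u) (fderiv ℝ ζ x w))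
  have h5 := hB.symm (Complex.I • fderiv ℝ ζ x v) (fderiv ℝ (fderiv ℝ ζ) x u w)
  have h6 := hB.symm (Complex.I • fderiv ℝ ζ x v)
    (christoffel G (ζ x) (fderiv ℝ ζ x u) (fderiv ℝ ζ x w))
  linarith

theorem christoffel_linear (w : Cn n) :
    ∃ T : Cn n →ₗ[ℂ] Cn n, ∀ v, T v = christoffel G (ζ x) w v :=
  ⟨{ toFun := fun v => christoffel G (ζ x) w v
     map_add' := map_add _
     map_smul' := fun c v => by
      simp only [smul_eq_re_add_im c, map_add, map_smul, RingHom.id_apply,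
        christoffel_I_smul h.differentiableAt_metric h.hermitian h.closed] }, fun _ => rfl⟩

theorem hasFDerivAt_dzForm (v : Fin n → E) :
    HasFDerivAt (fun y => dzForm n fun i => fderiv ℝ ζ y (v i))
      (∑ j, ((dzForm n).toContinuousMultilinearMap.toContinuousLinearMap
        (fun i => fderiv ℝ ζ x (v i)) j).comp ((fderiv ℝ (fderiv ℝ ζ) x).flip (v j))) x := by
  exact HasFDerivAt.multilinear_comp (dzForm n).toContinuousMultilinearMap fun i =>
    h.hasFDerivAt_fderiv_apply (v i)

/-- If `f dz₁ ∧ … ∧ dzₙ` is real on the Lagrangian immersion, then the imaginary part of its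
covariant derivative is given by the mean curvature. -/
theorem im_connection {v : Basis (Fin n) ℝ E}
    (hv : IsOrthonormalFor (G (ζ x)) (fderiv ℝ ζ x : E →ₗ[ℝ] Cn n) v) {f : E → ℂ}
    (hf : DifferentiableAt ℝ f x) (hf0 : f x ≠ 0)
    (hreal : ∀ᶠ y in 𝓝 x, (f y * dzForm n fun i => fderiv ℝ ζ y (v i)).im = 0) (u : E) :
    (fderiv ℝ f x u / f x + -∑ j, dzForm n (update (fun i => EuclideanSpace.single i (1 : ℂ)) j
      (christoffel G (ζ x) (fderiv ℝ ζ x u) (EuclideanSpace.single j 1)))).im =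
      - G (ζ x) (∑ j, covDeriv G ζ x (v j) (v j)) (Complex.I • fderiv ℝ ζ x u) := by
  have hB := h.hermitian.self_of_nhds
  have hτ := h.lagrangian.self_of_nhds
  set b := hτ.basis hB v with hb
  have hbv : ⇑b = fun i => fderiv ℝ ζ x (v i) := hτ.coe_basis hB v
  obtain ⟨T, hT⟩ := h.christoffel_linear (fderiv ℝ ζ x u)
  have hD : dzForm n b ≠ 0 := dzForm_basis_ne_zero b
  -- The connection form is minus the complex trace of `Γ(u, ·)`, and the trace may be computed in
  -- the frame `b` as well as in the standard basis.
  have htr : ∑ j, dzForm n (update (fun i => EuclideanSpace.single i (1 : ℂ)) j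
      (christoffel G (ζ x) (fderiv ℝ ζ x u) (EuclideanSpace.single j 1))) =
      LinearMap.trace ℂ _ T := by
    have h1 := sum_dzForm_update_map (EuclideanSpace.basisFun (Fin n) ℂ).toBasis T
    have h2 : ⇑(EuclideanSpace.basisFun (Fin n) ℂ).toBasis =
        fun i => EuclideanSpace.single i (1 : ℂ) := by ext i : 1; simp
    rw [h2, dzForm_single, one_mul] at h1
    simpa only [hT] using h1
  have htr' := sum_dzForm_update_map b T
  have hder := (hf.hasFDerivAt.mul (h.hasFDerivAt_dzForm v))
  have him : fderiv ℝ (fun y => (f y * dzForm n fun i => fderiv ℝ ζ y (v i)).im) x = 0 := by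
    have h0 : (fun y => (f y * dzForm n fun i => fderiv ℝ ζ y (v i)).im) =ᶠ[𝓝 x] fun _ => 0 :=
      hreal
    rw [h0.fderiv_eq, fderiv_fun_const]
    rfl
  have hder' := Complex.imCLM.hasFDerivAt.comp x hder
  have hder2 := congrArg (fun φ : E →L[ℝ] ℝ => φ u) (hder'.fderiv.symm.trans him)
  simp only [ContinuousLinearMap.comp_apply, add_apply, smul_apply, sum_apply, zero_apply,
    ContinuousLinearMap.flip_apply, Complex.imCLM_apply, smul_eq_mul] at hder2
  -- The second derivative of `ζ` is the covariant derivative minus the Christoffel term. The latter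
  -- contributes the same trace as the connection form.
  have hsum : ∑ j, (dzForm n).toContinuousMultilinearMap.toContinuousLinearMap
        (fun i => fderiv ℝ ζ x (v i)) j (fderiv ℝ (fderiv ℝ ζ) x u (v j)) =
      dzForm n b * (∑ j, b.repr (covDeriv G ζ x u (v j)) j - LinearMap.trace ℂ _ T) := by
    rw [mul_sub, ← htr', Finset.mul_sum, ← Finset.sum_sub_distrib]
    refine Finset.sum_congr rfl fun j _ => ?_
    rw [dzForm_update, ← mul_sub, ← Finsupp.sub_apply, ← map_sub, ← dzForm_update, hT, hbv,
      covDeriv, add_sub_cancel_right]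
    rfl
  rw [hsum, ← hbv] at hder2
  have hr : (f x * dzForm n b).im = 0 := by rw [hbv]; exact hreal.self_of_nhds
  have hr0 : (f x * dzForm n b).re ≠ 0 := fun h0 =>
    mul_ne_zero hf0 hD (Complex.ext h0 hr)
  set S := ∑ j, b.repr (covDeriv G ζ x u (v j)) j with hS
  -- The factor `f dz(b)` is real and nonzero at `x`, so the imaginary part of the other factor
  -- vanishes.
  have hmul : f x * (dzForm n b * (S - LinearMap.trace ℂ _ T)) + dzForm n b * fderiv ℝ f x u =
      (f x * dzForm n b) * (S - LinearMap.trace ℂ _ T + fderiv ℝ f x u / f x) := by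
    field_simp
  rw [hmul, Complex.mul_im, hr, zero_mul, add_zero] at hder2
  have hfin := (mul_eq_zero.1 hder2).resolve_left hr0
  -- The `j`-th summand is `g(∇_u e_j, J e_j)`; the symmetry of the cubic form moves `u` into the
  -- last slot.
  have hSim : S.im = G (ζ x) (∑ j, covDeriv G ζ x (v j) (v j)) (Complex.I • fderiv ℝ ζ x u) := by
    rw [hS, Complex.im_sum, map_sum, sum_apply]
    refine Finset.sum_congr rfl fun j _ => ?_
    rw [hb, hτ.repr_im hB hv, h.covDeriv_symm u]
    exact h.inner_covDeriv_comm _ _ _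
  rw [htr, ← hSim]
  simp only [Complex.add_im, Complex.sub_im, Complex.neg_im] at hfin ⊢
  linarith

end IsLocalLagrangian

end LocalLagrangian

/-! ### The metric in a chart -/

theorem contDiffAt_clm_apply {D E F : Type*} [NormedAddCommGroup D] [NormedSpace ℝ D]
    [NormedAddCommGroup E] [NormedSpace ℝ E] [NormedAddCommGroup F] [NormedSpace ℝ F]
    [FiniteDimensional ℝ E] {k : ℕ∞ω} {f : D → E →L[ℝ] F} {x : D}
    (h : ∀ y, ContDiffAt ℝ k (fun x => f x y) x) : ContDiffAt ℝ k f x := by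
  let e₁ := ContinuousLinearEquiv.ofFinrankEq (finrank_fin_fun ℝ (n := finrank ℝ E)).symm
  let e₂ := (e₁.arrowCongr (1 : F ≃L[ℝ] F)).trans (ContinuousLinearEquiv.piRing (Fin _))
  rw [← id_comp f, ← e₂.symm_comp_self]
  exact e₂.symm.contDiff.contDiffAt.comp x (contDiffAt_pi.mpr fun i => h _)

section ChartMetric

variable {n : ℕ} {N : Type*} [TopologicalSpace N] [ChartedSpace (Cn n) N]

theorem extChartAt_symm_mem_source {x : N} {z : Cn n}
    (hz : z ∈ (extChartAt 𝓘(ℝ, Cn n) x).target) :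
    (extChartAt 𝓘(ℝ, Cn n) x).symm z ∈ (chartAt (Cn n) x).source := by
  have := (extChartAt 𝓘(ℝ, Cn n) x).map_target hz
  rwa [extChartAt_source] at this

variable [IsManifold 𝓘(ℂ, Cn n) ω N]

/-- The derivative at `y` of the transition map from the preferred chart at `x` to the preferred chart
at `y`. -/
def chartDeriv (x y : N) : Cn n →L[ℂ] Cn n :=
  (tangentBundleCore 𝓘(ℂ, Cn n) N).coordChange (achart (Cn n) x) (achart (Cn n) y) y

theorem chartDeriv_self (x : N) : chartDeriv x x = ContinuousLinearMap.id ℂ (Cn n) :=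
  ContinuousLinearMap.ext fun v => (tangentBundleCore 𝓘(ℂ, Cn n) N).coordChange_self
    (achart (Cn n) x) x (mem_chart_source (Cn n) x) v

theorem coordChange_chartDeriv {x y : N} (hy : y ∈ (chartAt (Cn n) x).source) (v : Cn n) :
    (tangentBundleCore 𝓘(ℂ, Cn n) N).coordChange (achart (Cn n) y) (achart (Cn n) x) y
      (chartDeriv x y v) = v := by
  rw [chartDeriv, (tangentBundleCore 𝓘(ℂ, Cn n) N).coordChange_comp (achart (Cn n) x)
    (achart (Cn n) y) (achart (Cn n) x) y ⟨⟨hy, mem_chart_source (Cn n) y⟩, hy⟩]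
  exact (tangentBundleCore 𝓘(ℂ, Cn n) N).coordChange_self (achart (Cn n) x) y hy v

theorem chartDeriv_injective {x y : N} (hy : y ∈ (chartAt (Cn n) x).source) :
    Injective (chartDeriv (n := n) x y) :=
  LeftInverse.injective (coordChange_chartDeriv hy)

theorem real_coordChange_of_mem {x x' y : N} (hx : y ∈ (chartAt (Cn n) x).source)
    (hx' : y ∈ (chartAt (Cn n) x').source) :
    (tangentBundleCore 𝓘(ℝ, Cn n) N).coordChange (achart (Cn n) x) (achart (Cn n) x') y =
      ((tangentBundleCore 𝓘(ℂ, Cn n) N).coordChange (achart (Cn n) x)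
        (achart (Cn n) x') y).restrictScalars ℝ := by
  have h : ContDiffWithinAt ℂ ω (extChartAt 𝓘(ℂ, Cn n) x' ∘ (extChartAt 𝓘(ℂ, Cn n) x).symm)
      (Set.range 𝓘(ℂ, Cn n)) (extChartAt 𝓘(ℂ, Cn n) x y) :=
    𝓘(ℂ, Cn n).contDiffWithinAt_extendCoordChange' (n := ω)
      (IsManifold.chart_mem_maximalAtlas x) (IsManifold.chart_mem_maximalAtlas x') hx hx'
  rw [modelWithCornersSelf_coe, Set.range_id, contDiffWithinAt_univ] at h
  rw [tangentBundleCore_coordChange_achart, tangentBundleCore_coordChange_achart]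
  simp only [modelWithCornersSelf_coe, Set.range_id, fderivWithin_univ]
  exact (h.differentiableAt (by simp)).fderiv_restrictScalars ℝ

theorem real_coordChange {x y : N} (hy : y ∈ (chartAt (Cn n) x).source) :
    (tangentBundleCore 𝓘(ℝ, Cn n) N).coordChange (achart (Cn n) x) (achart (Cn n) y) y =
      (chartDeriv x y).restrictScalars ℝ :=
  real_coordChange_of_mem hy (mem_chart_source (Cn n) y)

/-- The metric in a chart is thus a pullback by a complex linear map, and so remains Hermitian away
from the centre of the chart. -/
theorem mfderiv_extChartAt_symm {x : N} {z : Cn n} (hz : z ∈ (extChartAt 𝓘(ℝ, Cn n) x).target) :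
    (mfderiv 𝓘(ℝ, Cn n) 𝓘(ℝ, Cn n) (extChartAt 𝓘(ℝ, Cn n) x).symm z : Cn n →L[ℝ] Cn n) =
      (chartDeriv x ((extChartAt 𝓘(ℝ, Cn n) x).symm z)).restrictScalars ℝ := by
  have hy := extChartAt_symm_mem_source hz
  rw [← real_coordChange hy, ← TangentBundle.symmL_trivializationAt_eq_core hy,
    TangentBundle.symmL_trivializationAt hy, (extChartAt 𝓘(ℝ, Cn n) x).right_inv hz]
  rw [modelWithCornersSelf_coe, Set.range_id, mfderivWithin_univ]

theorem chartMetric_apply (g : RMetric n N) {x : N} {z : Cn n}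
    (hz : z ∈ (extChartAt 𝓘(ℝ, Cn n) x).target) (v w : Cn n) :
    chartMetric g x z v w = inn g ((extChartAt 𝓘(ℝ, Cn n) x).symm z)
      (chartDeriv x ((extChartAt 𝓘(ℝ, Cn n) x).symm z) v)
      (chartDeriv x ((extChartAt 𝓘(ℝ, Cn n) x).symm z) w) := by
  rw [chartMetric, mfderiv_extChartAt_symm hz]
  rfl

theorem IsKahlerEinstein.isHermitianInner {g : RMetric n N} {t : ℝ} (hg : IsKahlerEinstein g t)
    (x : N) : IsHermitianInner (inn g x) where
  symm := g.symm x
  pos := g.pos x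
  herm := hg.hermitian x

theorem IsKahlerEinstein.isHermitianInner_chartMetric {g : RMetric n N} {t : ℝ}
    (hg : IsKahlerEinstein g t) {x : N} {z : Cn n} (hz : z ∈ (extChartAt 𝓘(ℝ, Cn n) x).target) :
    IsHermitianInner (chartMetric g x z) where
  symm v w := by
    rw [chartMetric_apply g hz, chartMetric_apply g hz, (hg.isHermitianInner _).symm]
  pos v hv := by
    rw [chartMetric_apply g hz]
    have hy := extChartAt_symm_mem_source hz
    refine (hg.isHermitianInner _).pos _ fun h => hv (chartDeriv_injective hy ?_)
    rw [h, map_zero]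
  herm v w := by
    rw [chartMetric_apply g hz, chartMetric_apply g hz, map_smul (chartDeriv _ _),
      map_smul (chartDeriv _ _),
      (hg.isHermitianInner _).herm]

theorem chartMetric_center (g : RMetric n N) (x : N) :
    chartMetric g x (extChartAt 𝓘(ℝ, Cn n) x x) = inn g x := by
  ext v w
  rw [chartMetric_apply g (mem_extChartAt_target x), extChartAt_to_inv, chartDeriv_self]
  rfl

theorem contMDiffAt_trivialization_symmL (x : N) (v : Cn n) :
    ContMDiffAt 𝓘(ℝ, Cn n) (𝓘(ℝ, Cn n).prod 𝓘(ℝ, Cn n)) ∞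
      (fun y => Bundle.TotalSpace.mk' (Cn n) (E := fun y : N => TangentSpace 𝓘(ℝ, Cn n) y) y
        ((trivializationAt (Cn n) (TangentSpace 𝓘(ℝ, Cn n)) x).symmL ℝ y v)) x := by
  rw [Bundle.contMDiffAt_section]
  refine (contMDiffAt_const (c := v)).congr_of_eventuallyEq ?_
  filter_upwards [(trivializationAt (Cn n) (TangentSpace 𝓘(ℝ, Cn n)) x).open_baseSet.mem_nhds
    (FiberBundle.mem_baseSet_trivializationAt' x)] with y hy
  rw [Bundle.Trivialization.symmL_apply,
    Bundle.Trivialization.apply_mk_symm _ hy]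
  exact hy

/-- Smoothness of the bundle metric is tested on vector fields with constant coordinates in the
chart, and a bilinear form is determined smoothly by such values in finite dimension. -/
theorem contDiffAt_chartMetric (g : RMetric n N) (x : N) :
    ContDiffAt ℝ ∞ (chartMetric g x) (extChartAt 𝓘(ℝ, Cn n) x x) := by
  have key : ∀ v w : Cn n, ContDiffAt ℝ ∞ (fun z => chartMetric g x z v w)
      (extChartAt 𝓘(ℝ, Cn n) x x) := by
    intro v w
    have h1 : ContMDiffAt 𝓘(ℝ, Cn n) (𝓘(ℝ, Cn n).prod 𝓘(ℝ)) ∞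
      (fun m ↦ Bundle.TotalSpace.mk' ℝ (E := Bundle.Trivial N ℝ) m (g.inner m
        ((trivializationAt (Cn n) (TangentSpace 𝓘(ℝ, Cn n)) x).symmL ℝ m v)
        ((trivializationAt (Cn n) (TangentSpace 𝓘(ℝ, Cn n)) x).symmL ℝ m w))) x := by
      apply ContMDiffAt.clm_bundle_apply₂ (F₁ := Cn n) (F₂ := Cn n)
      · exact g.contMDiff.contMDiffAt
      · exact contMDiffAt_trivialization_symmL x v
      · exact contMDiffAt_trivialization_symmL x w
    rw [Bundle.contMDiffAt_totalSpace] at h1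
    have h2 := h1.2
    have h3 : ContMDiffAt 𝓘(ℝ, Cn n) 𝓘(ℝ, Cn n) ∞ (extChartAt 𝓘(ℝ, Cn n) x).symm
        (extChartAt 𝓘(ℝ, Cn n) x x) :=
      (contMDiffOn_extChartAt_symm x).contMDiffAt (extChartAt_target_mem_nhds x)
    have h4 := ContMDiffAt.comp_of_eq h2 h3 (extChartAt_to_inv x)
    rw [contMDiffAt_iff_contDiffAt] at h4
    refine h4.congr_of_eventuallyEq ?_
    filter_upwards [extChartAt_target_mem_nhds (I := 𝓘(ℝ, Cn n)) x] with z hz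
    have hy := extChartAt_symm_mem_source hz
    rw [chartMetric_apply g hz, comp_apply, TangentBundle.symmL_trivializationAt_eq_core hy,
      real_coordChange hy]
    rfl
  exact contDiffAt_clm_apply fun v => contDiffAt_clm_apply fun w => key v w

end ChartMetric

/-! ### Lagrangian immersions in charts -/

section Immersion

variable {n : ℕ} {N : Type*} [TopologicalSpace N] [ChartedSpace (Cn n) N]
  {L : Type*} [TopologicalSpace L] [ChartedSpace (EuclideanSpace ℝ (Fin n)) L]

/-- The map `ι` in the preferred charts at `l` and `ι l`. -/
abbrev localRep (ι : L → N) (l : L) : EuclideanSpace ℝ (Fin n) → Cn n :=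
  writtenInExtChartAt (𝓡 n) 𝓘(ℝ, Cn n) l ι

theorem localRep_center (ι : L → N) (l : L) :
    localRep (n := n) ι l (extChartAt (𝓡 n) l l) = extChartAt 𝓘(ℝ, Cn n) (ι l) (ι l) := by
  simp [localRep, writtenInExtChartAt]

theorem contDiffAt_localRep {ι : L → N} {l : L} (hι : ContMDiffAt (𝓡 n) 𝓘(ℝ, Cn n) ∞ ι l) :
    ContDiffAt ℝ ∞ (localRep (n := n) ι l) (extChartAt (𝓡 n) l l) := by
  have h := (contMDiffAt_iff.1 hι).2
  rwa [modelWithCornersSelf_coe, Set.range_id, contDiffWithinAt_univ] at h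

theorem tmap_eq_fderiv {ι : L → N} {l : L} (hι : ContMDiffAt (𝓡 n) 𝓘(ℝ, Cn n) ∞ ι l) :
    tmap (n := n) ι l = fderiv ℝ (localRep (n := n) ι l) (extChartAt (𝓡 n) l l) := by
  rw [tmap, (hι.mdifferentiableAt (by simp)).mfderiv, modelWithCornersSelf_coe, Set.range_id,
    fderivWithin_univ]

/-- The points near the centre of the chart at `l` that the chart at `ι l` covers. -/
theorem eventually_mem_chart {ι : L → N} {l : L} (hι : ContinuousAt ι l) :
    ∀ᶠ x in 𝓝 (extChartAt (𝓡 n) l l), x ∈ (extChartAt (𝓡 n) l).target ∧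
      ι ((extChartAt (𝓡 n) l).symm x) ∈ (chartAt (Cn n) (ι l)).source := by
  refine Filter.Eventually.and (extChartAt_target_mem_nhds (I := 𝓡 n) l) ?_
  have h1 : Filter.Tendsto (fun x => ι ((extChartAt (𝓡 n) l).symm x))
      (𝓝 (extChartAt (𝓡 n) l l)) (𝓝 (ι l)) := by
    have := (continuousAt_extChartAt_symm (I := 𝓡 n) l).tendsto
    rw [extChartAt_to_inv] at this
    exact hι.tendsto.comp this
  exact h1.eventually ((chartAt (Cn n) (ι l)).open_source.mem_nhds (mem_chart_source _ _))

variable [IsManifold 𝓘(ℂ, Cn n) ω N]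

theorem IsLagrangian.isLagrangianMap {g : RMetric n N} {ι : L → N} (hι : IsLagrangian g ι)
    (l : L) : IsLagrangianMap (inn g (ι l)) (tmap (n := n) ι l).toLinearMap where
  injective := hι.immersion l
  isotropic := hι.lagrangian l

theorem chartMetric_localRep (g : RMetric n N) {ι : L → N} {l : L} {x : EuclideanSpace ℝ (Fin n)}
    (hx : ι ((extChartAt (𝓡 n) l).symm x) ∈ (chartAt (Cn n) (ι l)).source) (v w : Cn n) :
    chartMetric g (ι l) (localRep (n := n) ι l x) v w = inn g (ι ((extChartAt (𝓡 n) l).symm x))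
      (chartDeriv (ι l) (ι ((extChartAt (𝓡 n) l).symm x)) v)
      (chartDeriv (ι l) (ι ((extChartAt (𝓡 n) l).symm x)) w) := by
  have hz : localRep (n := n) ι l x ∈ (extChartAt 𝓘(ℝ, Cn n) (ι l)).target :=
    (extChartAt 𝓘(ℝ, Cn n) (ι l)).map_source (by rwa [extChartAt_source])
  have hinv : (extChartAt 𝓘(ℝ, Cn n) (ι l)).symm (localRep (n := n) ι l x) =
      ι ((extChartAt (𝓡 n) l).symm x) :=
    (extChartAt 𝓘(ℝ, Cn n) (ι l)).left_inv (by rwa [extChartAt_source])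
  rw [chartMetric_apply g hz, hinv]

variable [IsManifold (𝓡 n) ∞ L]

/-- At a point near `l` the tangent spaces carry the coordinates of that point's own preferred
charts, so transition maps appear on both sides. The formula is the chain rule for `ι` after the
inverse chart of `L`, which equals the inverse chart of `N` after `localRep`. -/
theorem chartDeriv_fderiv_localRep {ι : L → N} (hι : ContMDiff (𝓡 n) 𝓘(ℝ, Cn n) ∞ ι) (l : L) :
    ∀ᶠ x in 𝓝 (extChartAt (𝓡 n) l l), ∀ v : EuclideanSpace ℝ (Fin n),
      chartDeriv (n := n) (ι l) (ι ((extChartAt (𝓡 n) l).symm x))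
          (fderiv ℝ (localRep (n := n) ι l) x v) =
        tmap (n := n) ι ((extChartAt (𝓡 n) l).symm x)
          ((trivializationAt (EuclideanSpace ℝ (Fin n)) (TangentSpace (𝓡 n)) l).symmL ℝ
            ((extChartAt (𝓡 n) l).symm x) v) := by
  have hev := eventually_mem_chart (n := n) (hι l).continuousAt
  have hdiff : ∀ᶠ x in 𝓝 (extChartAt (𝓡 n) l l),
      DifferentiableAt ℝ (localRep (n := n) ι l) x := by
    have h1 : ContDiffAt ℝ 1 (localRep (n := n) ι l) (extChartAt (𝓡 n) l l) :=
      (contDiffAt_localRep (hι l)).of_le (by exact_mod_cast le_top)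
    filter_upwards [h1.eventually (by simp)] with x hx using hx.differentiableAt (by simp)
  filter_upwards [hev.eventually_nhds, hdiff] with x hx hd v
  obtain ⟨hxt, hxs⟩ := hx.self_of_nhds
  have hls : (extChartAt (𝓡 n) l).symm x ∈ (chartAt (EuclideanSpace ℝ (Fin n)) l).source := by
    have := (extChartAt (𝓡 n) l).map_target hxt
    rwa [extChartAt_source] at this
  have hz : localRep (n := n) ι l x ∈ (extChartAt 𝓘(ℝ, Cn n) (ι l)).target :=
    (extChartAt 𝓘(ℝ, Cn n) (ι l)).map_source (by rwa [extChartAt_source])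
  have hinv : (extChartAt 𝓘(ℝ, Cn n) (ι l)).symm (localRep (n := n) ι l x) =
      ι ((extChartAt (𝓡 n) l).symm x) :=
    (extChartAt 𝓘(ℝ, Cn n) (ι l)).left_inv (by rwa [extChartAt_source])
  have heq : (ι ∘ (extChartAt (𝓡 n) l).symm) =ᶠ[𝓝 x]
      ((extChartAt 𝓘(ℝ, Cn n) (ι l)).symm ∘ localRep (n := n) ι l) := by
    filter_upwards [hx] with y hy
    exact ((extChartAt 𝓘(ℝ, Cn n) (ι l)).left_inv (by rw [extChartAt_source]; exact hy.2)).symm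
  have hs1 : MDifferentiableAt (𝓡 n) (𝓡 n) (extChartAt (𝓡 n) l).symm x :=
    ((contMDiffOn_extChartAt_symm (n := ∞) l).contMDiffAt
      ((isOpen_extChartAt_target l).mem_nhds hxt)).mdifferentiableAt (by simp)
  have hs2 : MDifferentiableAt 𝓘(ℝ, Cn n) 𝓘(ℝ, Cn n) (extChartAt 𝓘(ℝ, Cn n) (ι l)).symm
      (localRep (n := n) ι l x) :=
    ((contMDiffOn_extChartAt_symm (n := ω) (ι l)).contMDiffAt
      ((isOpen_extChartAt_target (ι l)).mem_nhds hz)).mdifferentiableAt (by simp)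
  have hL := mfderiv_comp x ((hι _).mdifferentiableAt (by simp)) hs1
  have hR := mfderiv_comp x hs2 hd.mdifferentiableAt
  have hE : (mfderiv (𝓡 n) 𝓘(ℝ, Cn n) (ι ∘ (extChartAt (𝓡 n) l).symm) x :
      EuclideanSpace ℝ (Fin n) →L[ℝ] Cn n) = mfderiv (𝓡 n) 𝓘(ℝ, Cn n)
        ((extChartAt 𝓘(ℝ, Cn n) (ι l)).symm ∘ localRep (n := n) ι l) x := heq.mfderiv_eq
  have h1 : (mfderiv (𝓡 n) 𝓘(ℝ, Cn n) (ι ∘ (extChartAt (𝓡 n) l).symm) x :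
      EuclideanSpace ℝ (Fin n) →L[ℝ] Cn n) v = tmap (n := n) ι ((extChartAt (𝓡 n) l).symm x)
        (mfderiv (𝓡 n) (𝓡 n) (extChartAt (𝓡 n) l).symm x v) := by rw [hL]; rfl
  have h2 : (mfderiv (𝓡 n) 𝓘(ℝ, Cn n)
        ((extChartAt 𝓘(ℝ, Cn n) (ι l)).symm ∘ localRep (n := n) ι l) x :
      EuclideanSpace ℝ (Fin n) →L[ℝ] Cn n) v =
      (mfderiv 𝓘(ℝ, Cn n) 𝓘(ℝ, Cn n) (extChartAt 𝓘(ℝ, Cn n) (ι l)).symm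
        (localRep (n := n) ι l x) : Cn n →L[ℝ] Cn n)
        (fderiv ℝ (localRep (n := n) ι l) x v) := by
    rw [hR, mfderiv_eq_fderiv]; rfl
  rw [mfderiv_extChartAt_symm hz, hinv] at h2
  rw [TangentBundle.symmL_trivializationAt hls, (extChartAt (𝓡 n) l).right_inv hxt,
    modelWithCornersSelf_coe, Set.range_id, mfderivWithin_univ]
  exact (h1.symm.trans ((congrArg (fun φ : EuclideanSpace ℝ (Fin n) →L[ℝ] Cn n => φ v) hE).trans
    h2)).symm

theorem IsLagrangian.isLocalLagrangian {g : RMetric n N} {t : ℝ} (hg : IsKahlerEinstein g t)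
    {ι : L → N} (hι : IsLagrangian g ι) (l : L) :
    IsLocalLagrangian (chartMetric g (ι l)) (localRep (n := n) ι l) (extChartAt (𝓡 n) l l) where
  contDiff_metric := by
    rw [localRep_center]
    exact contDiffAt_chartMetric g (ι l)
  hermitian := by
    rw [localRep_center]
    filter_upwards [extChartAt_target_mem_nhds (I := 𝓘(ℝ, Cn n)) (ι l)] with z hz
    exact hg.isHermitianInner_chartMetric hz
  closed := by
    rw [localRep_center]
    exact hg.closed (ι l)
  contDiff := contDiffAt_localRep (hι.smooth l)
  lagrangian := by
    filter_upwards [eventually_mem_chart (n := n) (hι.smooth l).continuousAt,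
      chartDeriv_fderiv_localRep hι.smooth l] with x ⟨hxt, hxs⟩ hx
    have hls : (extChartAt (𝓡 n) l).symm x ∈ (trivializationAt (EuclideanSpace ℝ (Fin n))
        (TangentSpace (𝓡 n)) l).baseSet := by
      have := (extChartAt (𝓡 n) l).map_target hxt
      rwa [extChartAt_source] at this
    constructor
    · intro v w hvw
      have h1 := congrArg (chartDeriv (n := n) (ι l) (ι ((extChartAt (𝓡 n) l).symm x))) hvw
      have h2 := hι.immersion _ ((hx v).symm.trans (h1.trans (hx w)))
      have h3 := congrArg ((trivializationAt (EuclideanSpace ℝ (Fin n))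
        (TangentSpace (𝓡 n)) l).continuousLinearMapAt ℝ ((extChartAt (𝓡 n) l).symm x)) h2
      rwa [Bundle.Trivialization.continuousLinearMapAt_symmL _ hls,
        Bundle.Trivialization.continuousLinearMapAt_symmL _ hls] at h3
    · intro v w
      rw [chartMetric_localRep g hxs, map_smul (chartDeriv _ _)]
      erw [hx, hx]
      exact hι.lagrangian _ _ _


end Immersion

/-! ### The section of the canonical bundle given by the volume form -/

section VolumeSection

variable {n : ℕ} {N : Type*} [TopologicalSpace N] [ChartedSpace (Cn n) N]
  [IsManifold 𝓘(ℂ, Cn n) ω N]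
  {L : Type*} [TopologicalSpace L] [ChartedSpace (EuclideanSpace ℝ (Fin n)) L]

/-- The coefficient of `dz₁ ∧ … ∧ dzₙ` in an element of a fibre of the canonical bundle. -/
def fiberVal {x : N} (a : CanonicalFiber n N x) : ℂ := a

/-- `κ` restricts on each tangent space of `L` to the volume form, expressed in arbitrary frames. -/
def IsVolumeSection (g : RMetric n N) (ι : L → N)
    (o : ∀ l : L, Orientation ℝ (TangentSpace (𝓡 n) l) (Fin n))
    (κ : ∀ l, CanonicalFiber n N (ι l)) : Prop :=
  ∀ (l : L) (w : Basis (Fin n) ℝ (TangentSpace (𝓡 n) l)),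
    fiberVal (κ l) * dzForm n (fun i => tmap ι l (w i)) =
      ((orientSign (o l) w *
        Real.sqrt (gram (inn g (ι l)) (tmap (n := n) ι l).toLinearMap w).det : ℝ) : ℂ)

/-- The standard basis of a tangent space. -/
def tangentBasis (l : L) : Basis (Fin n) ℝ (TangentSpace (𝓡 n) l) :=
  (EuclideanSpace.basisFun (Fin n) ℝ).toBasis

variable {g : RMetric n N} {t : ℝ} (hg : IsKahlerEinstein g t) {ι : L → N}
  (hι : IsLagrangian g ι) {o : ∀ l : L, Orientation ℝ (TangentSpace (𝓡 n) l) (Fin n)}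
  {κ : ∀ l, CanonicalFiber n N (ι l)}

include hg hι

theorem exists_isVolumeSection : ∃ κ : ∀ l, CanonicalFiber n N (ι l), IsVolumeSection g ι o κ := by
  choose κ hκ using fun l => (hι.isLagrangianMap l).exists_volume (hg.isHermitianInner (ι l)) (o l)
    (tangentBasis l)
  exact ⟨κ, hκ⟩

theorem exists_isOrthonormalFrame (l : L) : ∃ v, IsOrthonormalFrame g ι l v :=
  (hg.isHermitianInner (ι l)).exists_orthonormal (hι.isLagrangianMap l).injective (tangentBasis l)

/-- Orthonormal frames have Gram determinant `1`. One such frame suffices for uniqueness, because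
`dz₁ ∧ … ∧ dzₙ` does not vanish on it. -/
theorem restrictsToVolume_iff (hκ : IsVolumeSection g ι o κ) (l : L)
    (a : CanonicalFiber n N (ι l)) : RestrictsToVolume g ι o l a ↔ a = κ l := by
  have hval : ∀ v, IsOrthonormalFrame g ι l v →
      fiberForm (ι l) (κ l) (fun i => tmap ι l (v i)) = (orientSign (o l) v : ℂ) := by
    intro v hv
    have h := hκ l v
    have hv' : IsOrthonormalFor (inn g (ι l)) (tmap (n := n) ι l).toLinearMap v := hv
    rw [det_gram_orthonormal hv', Real.sqrt_one, mul_one] at h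
    exact h
  constructor
  · intro ha
    obtain ⟨v, hv⟩ := exists_isOrthonormalFrame hg hι l
    have h1 : fiberForm (ι l) a (fun i => tmap ι l (v i)) = (orientSign (o l) v : ℂ) := by
      unfold orientSign
      split_ifs with h
      · simpa using (ha v hv).1 h
      · simpa using (ha v hv).2 h
    have hne : dzForm n (fun i => tmap ι l (v i)) ≠ 0 :=
      (hι.isLagrangianMap l).dzForm_ne_zero (hg.isHermitianInner (ι l)) v
    exact mul_right_cancel₀ (M₀ := ℂ) hne (h1.trans (hval v hv).symm)
  · rintro rfl v hv
    rw [hval v hv]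
    unfold orientSign
    constructor <;> intro h <;> simp [h]

theorem IsVolumeSection.ne_zero (hκ : IsVolumeSection g ι o κ) (l : L) :
    fiberVal (κ l) ≠ 0 := by
  intro h
  have h1 := hκ l (tangentBasis l)
  rw [h, zero_mul] at h1
  have h2 := det_gram_pos (hg.isHermitianInner (ι l)) (hι.isLagrangianMap l).injective
    (tangentBasis l)
  have h3 := mul_ne_zero (orientSign_ne_zero (o l) (tangentBasis l)) (Real.sqrt_pos.2 h2).ne'
  exact h3 (by exact_mod_cast h1.symm)

omit hg hι

/-- The fibre coordinate of `κ` near `l`, over the preferred chart at `ι l`. -/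
def fiberCoord (ι : L → N) (κ : ∀ l, CanonicalFiber n N (ι l)) (l l' : L) : ℂ :=
  (trivializationAt ℂ (CanonicalFiber n N) (ι l) ⟨ι l', κ l'⟩).2

theorem trivializationAt_canonical (x : N) (p : CanonicalBundle n N) :
    trivializationAt ℂ (CanonicalFiber n N) x p =
      (p.proj, (chartDeriv (n := n) x p.proj).det * fiberVal p.snd) := rfl

theorem fiberCoord_eq {L : Type*} {ι : L → N} {κ : ∀ l, CanonicalFiber n N (ι l)} (l l' : L) :
    fiberCoord ι κ l l' = (chartDeriv (n := n) (ι l) (ι l')).det * fiberVal (κ l') := rfl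

theorem fiberCoord_self {L : Type*} {ι : L → N} {κ : ∀ l, CanonicalFiber n N (ι l)} (l : L) :
    fiberCoord ι κ l l = fiberVal (κ l) := by
  rw [fiberCoord_eq, chartDeriv_self]
  simp [ContinuousLinearMap.det]

variable [IsManifold (𝓡 n) ∞ L]

/-- The coordinate expression of `κ` near `l`. -/
abbrev localFiberCoord (ι : L → N) (κ : ∀ l, CanonicalFiber n N (ι l)) (l : L)
    (x : EuclideanSpace ℝ (Fin n)) : ℂ :=
  fiberCoord ι κ l ((extChartAt (𝓡 n) l).symm x)

/-- The determinant in the transition of the fibre coordinate is the one by which `dz₁ ∧ … ∧ dzₙ`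
changes on the frame, so the defining equation of `κ` carries over to the fixed chart at `ι l`.
Continuity of the orientation makes the sign `s` independent of `x`. -/
theorem IsVolumeSection.localFiberCoord_mul_dzForm (hι : IsLagrangian g ι) (ho : IsOrientation o)
    (hκ : IsVolumeSection g ι o κ) (l : L) (v : Basis (Fin n) ℝ (EuclideanSpace ℝ (Fin n))) :
    ∃ s : ℝ, ∀ᶠ x in 𝓝 (extChartAt (𝓡 n) l l),
      localFiberCoord ι κ l x * dzForm n (fun i => fderiv ℝ (localRep (n := n) ι l) x (v i)) =
        ((s * Real.sqrt (gram (chartMetric g (ι l) (localRep (n := n) ι l x))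
          (fderiv ℝ (localRep (n := n) ι l) x).toLinearMap v).det : ℝ) : ℂ) := by
  obtain ⟨o₀, ho₀⟩ := ho l
  refine ⟨orientSign o₀ v, ?_⟩
  have htend := (continuousAt_extChartAt_symm (I := 𝓡 n) l).tendsto
  rw [extChartAt_to_inv] at htend
  filter_upwards [eventually_mem_chart (n := n) (hι.smooth l).continuousAt,
    chartDeriv_fderiv_localRep hι.smooth l, htend.eventually ho₀] with x ⟨hxt, hxs⟩ hx hxo
  have hls : (extChartAt (𝓡 n) l).symm x ∈ (trivializationAt (EuclideanSpace ℝ (Fin n))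
      (TangentSpace (𝓡 n)) l).baseSet := by
    have := (extChartAt (𝓡 n) l).map_target hxt
    rwa [extChartAt_source] at this
  set l' := (extChartAt (𝓡 n) l).symm x with hl'
  let P := ((trivializationAt (EuclideanSpace ℝ (Fin n))
    (TangentSpace (𝓡 n)) l).continuousLinearEquivAt ℝ l' hls).toLinearEquiv
  let w : Basis (Fin n) ℝ (TangentSpace (𝓡 n) l') := v.map P.symm
  have hw : ∀ i, chartDeriv (n := n) (ι l) (ι l') (fderiv ℝ (localRep (n := n) ι l) x (v i)) =
      tmap (n := n) ι l' (w i) := fun i => by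
    rw [hx (v i), ← Bundle.Trivialization.symm_continuousLinearEquivAt_eq _ hls]
    rfl
  have hsign : orientSign (o l') w = orientSign o₀ v := by
    have h1 : w.orientation = o l' ↔ v.orientation = o₀ := by
      rw [← hxo hls, ← (Orientation.map (Fin n) P).injective.eq_iff, Basis.orientation_map,
        ← Orientation.map_symm, Equiv.apply_symm_apply]
    by_cases h : v.orientation = o₀
    · rw [orientSign, orientSign, if_pos h, if_pos (h1.2 h)]
    · rw [orientSign, orientSign, if_neg h, if_neg fun h' => h (h1.1 h')]
  have hgram : gram (chartMetric g (ι l) (localRep (n := n) ι l x))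
      (fderiv ℝ (localRep (n := n) ι l) x).toLinearMap v =
      gram (inn g (ι l')) (tmap (n := n) ι l').toLinearMap w := by
    ext i j
    have := chartMetric_localRep g hxs (fderiv ℝ (localRep (n := n) ι l) x (v i))
      (fderiv ℝ (localRep (n := n) ι l) x (v j))
    rw [← hl', hw, hw] at this
    exact this
  have hκ' := hκ l' w
  rw [hgram, ← hsign, ← hκ', localFiberCoord, fiberCoord_eq, mul_right_comm, mul_comm]
  congr 1
  have := dzForm_map (chartDeriv (n := n) (ι l) (ι l')).toLinearMap
    (fun i => fderiv ℝ (localRep (n := n) ι l) x (v i))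
  refine this.symm.trans ?_
  congr 1
  funext i
  exact hw i

/-- The preceding equation is solved for the coordinate of `κ`: the Gram determinant is positive, so
its root is smooth, and the divisor does not vanish. -/
theorem IsVolumeSection.contDiffAt_localFiberCoord (hg : IsKahlerEinstein g t)
    (hι : IsLagrangian g ι) (ho : IsOrientation o) (hκ : IsVolumeSection g ι o κ) (l : L) :
    ContDiffAt ℝ ∞ (localFiberCoord (n := n) ι κ l) (extChartAt (𝓡 n) l l) := by
  let v : Basis (Fin n) ℝ (EuclideanSpace ℝ (Fin n)) :=
    (EuclideanSpace.basisFun (Fin n) ℝ).toBasis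
  have hloc := hι.isLocalLagrangian hg l
  obtain ⟨s, hs⟩ := hκ.localFiberCoord_mul_dzForm hι ho l v
  have hB := hloc.hermitian.self_of_nhds
  have hE : ∀ i, ContDiffAt ℝ ∞ (fun x => fderiv ℝ (localRep (n := n) ι l) x (v i))
      (extChartAt (𝓡 n) l l) := fun i => hloc.contDiffAt_fderiv.clm_apply contDiffAt_const
  have hdz : ContDiffAt ℝ ∞
      (fun x => dzForm n (fun i => fderiv ℝ (localRep (n := n) ι l) x (v i)))
      (extChartAt (𝓡 n) l l) :=
    (dzForm n).toContinuousMultilinearMap.contDiff.contDiffAt.comp _ (contDiffAt_pi.2 hE)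
  have hG : ContDiffAt ℝ ∞ (fun x => chartMetric g (ι l) (localRep (n := n) ι l x))
      (extChartAt (𝓡 n) l l) := hloc.contDiff_metric.comp _ hloc.contDiff
  have hgram : ContDiffAt ℝ ∞ (fun x => (gram (chartMetric g (ι l) (localRep (n := n) ι l x))
          (fderiv ℝ (localRep (n := n) ι l) x).toLinearMap v).det) (extChartAt (𝓡 n) l l) := by
    simp only [Matrix.det_apply]
    refine ContDiffAt.sum fun σ _ => ContDiffAt.const_smul _ (contDiffAt_prod fun i _ => ?_)
    exact (hG.clm_apply (hE _)).clm_apply (hE _)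
  have hpos := det_gram_pos hB hloc.lagrangian.self_of_nhds.injective v
  have hne := hloc.lagrangian.self_of_nhds.dzForm_ne_zero hB v
  have hnum : ContDiffAt ℝ ∞ (fun x => ((s * Real.sqrt
      (gram (chartMetric g (ι l) (localRep (n := n) ι l x))
        (fderiv ℝ (localRep (n := n) ι l) x).toLinearMap v).det : ℝ) : ℂ))
      (extChartAt (𝓡 n) l l) :=
    Complex.ofRealCLM.contDiff.contDiffAt.comp _ (contDiffAt_const.mul (hgram.sqrt hpos.ne'))
  refine (hnum.mul (hdz.inv hne)).congr_of_eventuallyEq ?_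
  filter_upwards [hs, hdz.continuousAt.eventually_ne hne] with x hx hx0
  rw [← hx]
  exact (mul_inv_cancel_right₀ hx0 _).symm

end VolumeSection

/-! ### The holomorphic volume form in coordinates -/

section HolVolume

variable {n : ℕ} {N : Type*} [TopologicalSpace N] [ChartedSpace (Cn n) N]
  [IsManifold 𝓘(ℂ, Cn n) ω N]

theorem contMDiffOn_det_coordChange (x x' : N) :
    ContMDiffOn 𝓘(ℝ, Cn n) 𝓘(ℝ, ℂ) ∞ (fun y => ((tangentBundleCore 𝓘(ℂ, Cn n) N).coordChange
      (achart (Cn n) x) (achart (Cn n) x') y).det)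
      ((chartAt (Cn n) x).source ∩ (chartAt (Cn n) x').source) := by
  have : IsManifold 𝓘(ℝ, Cn n) (∞ + 1) N := IsManifold.of_le (n := ω) le_top
  have : (tangentBundleCore 𝓘(ℝ, Cn n) N).IsContMDiff 𝓘(ℝ, Cn n) ∞ :=
    tangentBundleCore.isContMDiff
  have h := (tangentBundleCore 𝓘(ℝ, Cn n) N).contMDiffOn_coordChange (n := ∞) 𝓘(ℝ, Cn n)
    (achart (Cn n) x) (achart (Cn n) x')
  -- `Φ` is polynomial on all real linear maps and is the complex determinant on complex linear
  -- ones, so smoothness of the real tangent bundle can be used.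
  let Φ : (Cn n →L[ℝ] Cn n) → ℂ := fun T => dzForm n fun i => T (EuclideanSpace.single i 1)
  have hΦ : ContDiff ℝ ∞ Φ :=
    (dzForm n).toContinuousMultilinearMap.contDiff.comp
      (contDiff_pi.2 fun i => contDiff_id.clm_apply contDiff_const)
  refine (hΦ.contMDiff.comp_contMDiffOn h).congr fun y hy => ?_
  rw [comp_apply, real_coordChange_of_mem hy.1 hy.2]
  have := dzForm_map ((tangentBundleCore 𝓘(ℂ, Cn n) N).coordChange
      (achart (Cn n) x) (achart (Cn n) x') y).toLinearMap
      (fun i => EuclideanSpace.single i (1 : ℂ))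
  rw [dzForm_single, mul_one] at this
  exact this.symm

theorem canonical_target (p : CanonicalBundle n N) :
    (extChartAt (modelK n) p).target = (extChartAt 𝓘(ℝ, Cn n) p.proj).target ×ˢ Set.univ := by
  rw [FiberBundle.extChartAt_target]
  congr 1
  refine Set.inter_eq_left.2 fun z hz => ?_
  exact extChartAt_symm_mem_source hz

theorem extChartAt_canonical (p q : CanonicalBundle n N) :
    extChartAt (modelK n) p q = (extChartAt 𝓘(ℝ, Cn n) p.proj q.proj,
      (chartDeriv (n := n) p.proj q.proj).det * fiberVal q.snd) := by
  rw [FiberBundle.extChartAt]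
  rfl

theorem extChartAt_canonical_symm (p : CanonicalBundle n N) (z : Cn n × ℂ) :
    (extChartAt (modelK n) p).symm z = ⟨(extChartAt 𝓘(ℝ, Cn n) p.proj).symm z.1,
      (canonicalCore n N).coordChange (achart (Cn n) p.proj)
        (achart (Cn n) ((extChartAt 𝓘(ℝ, Cn n) p.proj).symm z.1))
        ((extChartAt 𝓘(ℝ, Cn n) p.proj).symm z.1) z.2⟩ := by
  rw [FiberBundle.extChartAt]
  rfl

theorem contMDiffAt_extChartAt_canonical_symm {p : CanonicalBundle n N} {z : Cn n × ℂ}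
    (hz : z.1 ∈ (extChartAt 𝓘(ℝ, Cn n) p.proj).target) :
    ContMDiffAt 𝓘(ℝ, Cn n × ℂ) (modelK n) ∞ (extChartAt (modelK n) p).symm z := by
  have hnhds : ∀ᶠ z' : Cn n × ℂ in 𝓝 z, z'.1 ∈ (extChartAt 𝓘(ℝ, Cn n) p.proj).target :=
    continuousAt_fst.eventually ((isOpen_extChartAt_target p.proj).mem_nhds hz)
  have hbase : ContMDiffAt 𝓘(ℝ, Cn n × ℂ) 𝓘(ℝ, Cn n) ∞
      (fun z' : Cn n × ℂ => (extChartAt 𝓘(ℝ, Cn n) p.proj).symm z'.1) z :=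
    ContMDiffAt.comp (I' := 𝓘(ℝ, Cn n)) z
      ((contMDiffOn_extChartAt_symm p.proj).contMDiffAt
        ((isOpen_extChartAt_target p.proj).mem_nhds hz)) contDiff_fst.contMDiff.contMDiffAt
  have hy := extChartAt_symm_mem_source hz
  set x' := (extChartAt 𝓘(ℝ, Cn n) p.proj).symm z.1 with hx'
  have hproj : ((extChartAt (modelK n) p).symm z).proj = x' := by
    rw [extChartAt_canonical_symm]
  rw [Bundle.contMDiffAt_totalSpace]
  constructor
  · refine hbase.congr_of_eventuallyEq ?_
    filter_upwards [hnhds] with z' hz'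
    rw [extChartAt_canonical_symm]
  · have hdet : ContMDiffAt 𝓘(ℝ, Cn n × ℂ) 𝓘(ℝ, ℂ) ∞ (fun z' : Cn n × ℂ =>
        ((tangentBundleCore 𝓘(ℂ, Cn n) N).coordChange (achart (Cn n) x') (achart (Cn n) p.proj)
          ((extChartAt 𝓘(ℝ, Cn n) p.proj).symm z'.1)).det) z :=
      ContMDiffAt.comp (g := fun y => ((tangentBundleCore 𝓘(ℂ, Cn n) N).coordChange
          (achart (Cn n) x') (achart (Cn n) p.proj) y).det) z
        ((contMDiffOn_det_coordChange x' p.proj).contMDiffAt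
          (((chartAt (Cn n) x').open_source.inter
            (chartAt (Cn n) p.proj).open_source).mem_nhds ⟨mem_chart_source _ _, hy⟩)) hbase
    have hsnd : ContMDiffAt 𝓘(ℝ, Cn n × ℂ) 𝓘(ℝ, ℂ) ∞ (fun z' : Cn n × ℂ => z'.2) z :=
      contDiff_snd.contMDiff.contMDiffAt
    have hmem : ∀ᶠ z' : Cn n × ℂ in 𝓝 z,
        (extChartAt 𝓘(ℝ, Cn n) p.proj).symm z'.1 ∈ (chartAt (Cn n) x').source :=
      hbase.continuousAt.eventually ((chartAt (Cn n) x').open_source.mem_nhds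
        (mem_chart_source _ _))
    have hmul := (contDiff_mul (𝕜 := ℝ) (𝔸 := ℂ) (n := ∞)).contMDiff.contMDiffAt.comp z
      (hdet.prodMk_space hsnd)
    refine hmul.congr_of_eventuallyEq ?_
    filter_upwards [hnhds, hmem] with z' hz' hm
    rw [hproj, extChartAt_canonical_symm]
    exact (canonicalCore n N).coordChange_comp (achart (Cn n) p.proj) _ (achart (Cn n) x') _
      ⟨⟨extChartAt_symm_mem_source hz', mem_chart_source _ _⟩, hm⟩ z'.2

/-- In coordinates `ρ = y dz₁ ∧ … ∧ dzₙ`. The determinant from the differential of the projection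
and the one from the fibre coordinate are the same. -/
theorem tautologicalForm_chart {p : CanonicalBundle n N} {z : Cn n × ℂ}
    (hz : z.1 ∈ (extChartAt 𝓘(ℝ, Cn n) p.proj).target) :
    ((tautologicalForm ((extChartAt (modelK n) p).symm z)).compContinuousLinearMap
      (mfderiv 𝓘(ℝ, Cn n × ℂ) (modelK n) (extChartAt (modelK n) p).symm z) :
        (Cn n × ℂ) [⋀^Fin n]→L[ℝ] ℂ) =
      z.2 • (dzForm n).compContinuousLinearMap (ContinuousLinearMap.fst ℝ (Cn n) ℂ) := by
  have hnhds : ∀ᶠ z' : Cn n × ℂ in 𝓝 z, z'.1 ∈ (extChartAt 𝓘(ℝ, Cn n) p.proj).target :=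
    continuousAt_fst.eventually ((isOpen_extChartAt_target p.proj).mem_nhds hz)
  set x' := (extChartAt 𝓘(ℝ, Cn n) p.proj).symm z.1 with hx'
  set p' := (extChartAt (modelK n) p).symm z with hp'
  have hproj : p'.proj = x' := by rw [hp', extChartAt_canonical_symm]
  have hval : z.2 = (chartDeriv (n := n) p.proj p'.proj).det * fiberVal p'.snd := by
    have h1 : extChartAt (modelK n) p p' = z :=
      (extChartAt (modelK n) p).right_inv (by rw [canonical_target]; exact ⟨hz, trivial⟩)
    rw [extChartAt_canonical] at h1
    exact (congrArg Prod.snd h1).symm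
  have hL := mfderiv_comp z
    ((Bundle.contMDiffAt_proj (CanonicalFiber n N) (n := ∞) (IB := 𝓘(ℝ, Cn n))
      (p := p')).mdifferentiableAt (by simp))
    ((contMDiffAt_extChartAt_canonical_symm hz).mdifferentiableAt (by simp))
  have hR : MDifferentiableAt 𝓘(ℝ, Cn n) 𝓘(ℝ, Cn n) (extChartAt 𝓘(ℝ, Cn n) p.proj).symm z.1 :=
    ((contMDiffOn_extChartAt_symm (n := ∞) p.proj).contMDiffAt
        ((isOpen_extChartAt_target p.proj).mem_nhds hz)).mdifferentiableAt (by simp)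
  have hR' := mfderiv_comp (I := 𝓘(ℝ, Cn n × ℂ)) z hR
    (differentiableAt_fst (𝕜 := ℝ)).mdifferentiableAt
  have heq : (Bundle.TotalSpace.proj ∘ (extChartAt (modelK n) p).symm : Cn n × ℂ → N) =
      (extChartAt 𝓘(ℝ, Cn n) p.proj).symm ∘ Prod.fst := by
    funext z'
    rw [comp_apply, extChartAt_canonical_symm]
    rfl
  have hD : ∀ X : Cn n × ℂ,
      (mfderiv (modelK n) 𝓘(ℝ, Cn n) (Bundle.TotalSpace.proj : CanonicalBundle n N → N) p'
        (mfderiv 𝓘(ℝ, Cn n × ℂ) (modelK n) (extChartAt (modelK n) p).symm z X) : Cn n) =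
      chartDeriv (n := n) p.proj x' X.1 := by
    intro X
    have h1 : (mfderiv 𝓘(ℝ, Cn n × ℂ) 𝓘(ℝ, Cn n)
        (Bundle.TotalSpace.proj ∘ (extChartAt (modelK n) p).symm : Cn n × ℂ → N) z :
          Cn n × ℂ →L[ℝ] Cn n) X = mfderiv (modelK n) 𝓘(ℝ, Cn n)
        (Bundle.TotalSpace.proj : CanonicalBundle n N → N) p'
        (mfderiv 𝓘(ℝ, Cn n × ℂ) (modelK n) (extChartAt (modelK n) p).symm z X) := by
      rw [hL]; rfl
    have h2 : (mfderiv 𝓘(ℝ, Cn n × ℂ) 𝓘(ℝ, Cn n)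
        ((extChartAt 𝓘(ℝ, Cn n) p.proj).symm ∘ Prod.fst : Cn n × ℂ → N) z :
          Cn n × ℂ →L[ℝ] Cn n) X = (mfderiv 𝓘(ℝ, Cn n) 𝓘(ℝ, Cn n)
        (extChartAt 𝓘(ℝ, Cn n) p.proj).symm z.1 : Cn n →L[ℝ] Cn n) X.1 := by
      rw [hR', mfderiv_eq_fderiv, fderiv_fst]; rfl
    rw [mfderiv_extChartAt_symm hz] at h2
    refine h1.symm.trans (Eq.trans ?_ h2)
    congr 2
  ext X
  have h3 := dzForm_map (chartDeriv (n := n) p.proj x').toLinearMap (fun i => (X i).1)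
  have h4 : ((tautologicalForm p').compContinuousLinearMap
      (mfderiv 𝓘(ℝ, Cn n × ℂ) (modelK n) (extChartAt (modelK n) p).symm z) :
        (Cn n × ℂ) [⋀^Fin n]→L[ℝ] ℂ) X =
      fiberVal p'.snd * dzForm n (fun i => chartDeriv (n := n) p.proj x' (X i).1) := by
    refine Eq.trans ?_ (congrArg (fun w => fiberVal p'.snd * dzForm n w) (funext fun i => hD (X i)))
    rfl
  rw [h4, hval, hproj]
  refine (congrArg (fiberVal p'.snd * ·) h3).trans ?_
  change _ = _ * dzForm n (fun i => (X i).1)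
  rw [← mul_assoc, mul_comm (fiberVal _)]
  rfl

/-- In coordinates `(z, y)` the form `φ` is `dy ∧ dz₁ ∧ … ∧ dzₙ`. -/
theorem holVolumeForm_apply (p : CanonicalBundle n N) (X : Fin (n + 1) → Cn n × ℂ) :
    holVolumeForm p X = ∑ i : Fin (n + 1), (-1 : ℤ) ^ (i : ℕ) •
      ((X i).2 * dzForm n fun j => (i.removeNth X j).1) := by
  have hev : (fun z : Cn n × ℂ => ((tautologicalForm
      ((extChartAt (modelK n) p).symm z)).compContinuousLinearMap
        (mfderiv 𝓘(ℝ, Cn n × ℂ) (modelK n) (extChartAt (modelK n) p).symm z) :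
          (Cn n × ℂ) [⋀^Fin n]→L[ℝ] ℂ)) =ᶠ[𝓝 (extChartAt (modelK n) p p)]
      fun z => z.2 • (dzForm n).compContinuousLinearMap (ContinuousLinearMap.fst ℝ (Cn n) ℂ) := by
    filter_upwards [extChartAt_target_mem_nhds (I := modelK n) p] with z hz
    rw [canonical_target] at hz
    exact tautologicalForm_chart hz.1
  have hd : DifferentiableAt ℝ (fun z : Cn n × ℂ => z.2 •
      (dzForm n).compContinuousLinearMap (ContinuousLinearMap.fst ℝ (Cn n) ℂ))
      (extChartAt (modelK n) p p) := differentiableAt_snd.smul_const _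
  have h1 : holVolumeForm p = extDeriv (fun z : Cn n × ℂ => z.2 •
      (dzForm n).compContinuousLinearMap (ContinuousLinearMap.fst ℝ (Cn n) ℂ))
      (extChartAt (modelK n) p p) := hev.extDeriv_eq
  have h2 := extDeriv_apply hd X
  rw [h1]
  refine h2.trans (Finset.sum_congr rfl fun i _ => ?_)
  congr 1
  have h3 : (fun z : Cn n × ℂ => (z.2 • (dzForm n).compContinuousLinearMap
      (ContinuousLinearMap.fst ℝ (Cn n) ℂ)) (i.removeNth X)) =
      fun z => z.2 * dzForm n fun j => (i.removeNth X j).1 := rfl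
  rw [h3, fderiv_mul_const differentiableAt_snd, fderiv_snd]
  simp [mul_comm]

end HolVolume

/-! ### The norm on the canonical bundle -/

section Norm

variable {n : ℕ} {N : Type*} [TopologicalSpace N] [ChartedSpace (Cn n) N]
  [IsManifold 𝓘(ℂ, Cn n) ω N]

/-- The Hermitian form `h(v, w) = g(v, w) + i g(v, iw)`. -/
def hermForm (B : Cn n →L[ℝ] Cn n →L[ℝ] ℝ) (v w : Cn n) : ℂ :=
  (B v w : ℂ) + Complex.I * B v (Complex.I • w)

variable {B : Cn n →L[ℝ] Cn n →L[ℝ] ℝ}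

theorem hermForm_conj (hB : IsHermitianInner B) (v w : Cn n) :
    conj (hermForm B v w) = hermForm B w v := by
  have h1 := hB.symm v w
  have h2 := hB.symm v (Complex.I • w)
  have h3 := hB.I_smul_left w v
  apply Complex.ext <;> simp [hermForm] <;> linarith

theorem hermForm_smul_left (hB : IsHermitianInner B) (c : ℂ) (v w : Cn n) :
    hermForm B (c • v) w = c * hermForm B v w := by
  rw [hermForm, hermForm, bilin_complex_smul_left B c v w,
    bilin_complex_smul_left B c v (Complex.I • w), hB.herm v w, hB.I_smul_left v w]
  apply Complex.ext <;> simp [sub_eq_add_neg]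

theorem hermForm_sum_left {ι : Type*} (s : Finset ι) (v : ι → Cn n) (w : Cn n) :
    hermForm B (∑ i ∈ s, v i) w = ∑ i ∈ s, hermForm B (v i) w := by
  simp [hermForm, Finset.sum_add_distrib, Finset.mul_sum]

theorem hermForm_sum_sum (hB : IsHermitianInner B) (c : Fin n → ℂ) (v : Fin n → Cn n) :
    hermForm B (∑ i, c i • v i) (∑ i, c i • v i) =
      ∑ i, ∑ j, c i * hermForm B (v i) (v j) * conj (c j) := by
  rw [hermForm_sum_left]
  refine Finset.sum_congr rfl fun i _ => ?_
  rw [hermForm_smul_left hB, ← hermForm_conj hB, hermForm_sum_left, map_sum, Finset.mul_sum]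
  refine Finset.sum_congr rfl fun j _ => ?_
  rw [hermForm_smul_left hB, map_mul, hermForm_conj hB]
  ring

theorem hermForm_self (hB : IsHermitianInner B) (v : Cn n) : hermForm B v v = (B v v : ℂ) := by
  have h1 := hB.I_smul_left v v
  have h2 := hB.symm v (Complex.I • v)
  have h3 : B v (Complex.I • v) = 0 := by linarith
  simp [hermForm, h3]

open scoped ComplexOrder in
theorem IsKahlerEinstein.dzNormSq_pos {g : RMetric n N} {t : ℝ} (hg : IsKahlerEinstein g t)
    (x : N) : 0 < dzNormSq g x := by
  have hB := hg.isHermitianInner x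
  have hpd : (hermGram g x).PosDef := by
    refine Matrix.PosDef.of_dotProduct_mulVec_pos ?_ ?_
    · ext i j
      exact hermForm_conj hB _ _
    · intro c hc
      -- The coefficients are conjugated because `hermForm` is linear in its first argument, whereas
      -- `star c ⬝ᵥ H c` conjugates the left one.
      set X : Cn n := ∑ i, conj (c i) • EuclideanSpace.single i (1 : ℂ) with hX
      have h1 : star c ⬝ᵥ (hermGram g x).mulVec c = (inn g x X X : ℂ) := by
        rw [← hermForm_self hB, hX, hermForm_sum_sum hB]
        simp only [dotProduct, Matrix.mulVec, Finset.mul_sum, Complex.conj_conj]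
        refine Finset.sum_congr rfl fun i _ => Finset.sum_congr rfl fun j _ => ?_
        rw [← mul_assoc]
        rfl
      have h2 : X ≠ 0 := by
        intro h0
        refine hc (funext fun i => ?_)
        have := congrArg (fun y : Cn n => y i) h0
        simpa [hX, Pi.single_apply] using this
      rw [h1]
      exact_mod_cast hB.pos X h2
  have hdet := hpd.det_pos
  exact inv_pos.2 (Complex.lt_def.1 hdet).1

end Norm

/-! ### The cone over the volume section -/

section Cone

variable {n : ℕ} {N : Type*} [TopologicalSpace N] [ChartedSpace (Cn n) N]
  [IsManifold 𝓘(ℂ, Cn n) ω N]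
  {L : Type*} {ι : L → N} {κ : ∀ l, CanonicalFiber n N (ι l)}

theorem fiberVal_coneMap (q : L × ℝ) :
    fiberVal (coneMap ι κ q).snd = q.2 * fiberVal (κ q.1) := rfl

theorem trivializationAt_coneMap (l : L) (q : L × ℝ) :
    trivializationAt ℂ (CanonicalFiber n N) (ι l) (coneMap ι κ q) =
      (ι q.1, q.2 * fiberCoord ι κ l q.1) := by
  rw [trivializationAt_canonical, fiberVal_coneMap, fiberCoord_eq, mul_left_comm]
  rfl

/-- The inverse is continuous: `l` is recovered from the base point, and then `a` as the fibre
coordinate divided by that of `κ`, which is nonzero near `l`. -/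
theorem isEmbedding_coneMap [TopologicalSpace L] (hι : Topology.IsEmbedding ι)
    (hne : ∀ l, fiberVal (κ l) ≠ 0)
    (hcont : ∀ l, ContinuousAt (fiberCoord ι κ l) l) (hF : Continuous (coneMap ι κ)) :
    Topology.IsEmbedding (coneMap ι κ) := by
  refine ⟨Topology.isInducing_iff_nhds.2 fun q => le_antisymm
    (hF.tendsto q).le_comap ?_, ?_⟩
  -- The claim is `ℱ ≤ 𝓝 q`, that is, convergence of both components of `L × ℝ` along `ℱ`.
  · set ℱ := Filter.comap (coneMap ι κ) (𝓝 (coneMap ι κ q)) with hℱ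
    have hT : Filter.Tendsto (coneMap ι κ) ℱ (𝓝 (coneMap ι κ q)) := Filter.tendsto_comap
    have hproj : Filter.Tendsto (fun q' : L × ℝ => ι q'.1) ℱ (𝓝 (ι q.1)) :=
      ((FiberBundle.continuous_proj ℂ (CanonicalFiber n N)).tendsto (coneMap ι κ q)).comp hT
    have hfst : Filter.Tendsto (fun q' : L × ℝ => q'.1) ℱ (𝓝 q.1) := by
      rw [hι.isInducing.nhds_eq_comap, Filter.tendsto_comap_iff]
      exact hproj
    have htriv := ((trivializationAt ℂ (CanonicalFiber n N) (ι q.1)).continuousAt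
      ((Bundle.Trivialization.mem_source _).2
        (FiberBundle.mem_baseSet_trivializationAt' (F := ℂ) (E := CanonicalFiber n N)
          (ι q.1)) : coneMap ι κ q ∈ _)).tendsto.comp hT
    have hy : Filter.Tendsto (fun q' : L × ℝ => (q'.2 : ℂ) * fiberCoord ι κ q.1 q'.1) ℱ
        (𝓝 ((q.2 : ℂ) * fiberCoord ι κ q.1 q.1)) := by
      have := (continuous_snd.tendsto _).comp htriv
      simp only [comp_def, Bundle.Trivialization.coe_coe, trivializationAt_coneMap] at this
      exact this
    have hf := (hcont q.1).tendsto.comp hfst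
    have hf0 : fiberCoord ι κ q.1 q.1 ≠ 0 := by
      rw [fiberCoord_self]
      exact hne q.1
    have hdiv := hy.div hf hf0
    rw [mul_div_cancel_right₀ _ hf0] at hdiv
    have hsnd' : Filter.Tendsto (fun q' : L × ℝ => (q'.2 : ℂ)) ℱ (𝓝 (q.2 : ℂ)) := by
      refine hdiv.congr' ?_
      filter_upwards [hf.eventually_ne hf0] with q' hq'
      exact mul_div_cancel_right₀ _ hq'
    have hsnd : Filter.Tendsto (fun q' : L × ℝ => q'.2) ℱ (𝓝 q.2) := by
      have := (Complex.continuous_re.tendsto _).comp hsnd'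
      simpa [comp_def] using this
    have := hfst.prodMk_nhds hsnd
    exact Filter.tendsto_id'.1 this
  · rintro ⟨l, a⟩ ⟨l', a'⟩ h
    have h1 : l = l' := hι.injective (congrArg Bundle.TotalSpace.proj h)
    subst h1
    have h2 := congrArg (fun p => (trivializationAt ℂ (CanonicalFiber n N) (ι l) p).2) h
    simp only [trivializationAt_coneMap, fiberCoord_self] at h2
    have h3 := mul_right_cancel₀ (hne l) h2
    rw [Complex.ofReal_inj.1 h3]

variable [TopologicalSpace L] [ChartedSpace (EuclideanSpace ℝ (Fin n)) L]

theorem writtenInExtChartAt_coneMap (q : L × ℝ) :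
    writtenInExtChartAt ((𝓡 n).prod 𝓘(ℝ, ℝ)) (modelK n) q (coneMap ι κ) =
      fun y => (localRep (n := n) ι q.1 y.1,
        (y.2 : ℂ) * fiberCoord ι κ q.1 ((extChartAt (𝓡 n) q.1).symm y.1)) := by
  funext y
  rw [writtenInExtChartAt, comp_apply, comp_apply, FiberBundle.extChartAt, extChartAt_prod]
  change ((extChartAt 𝓘(ℝ, Cn n) (ι q.1)).prod (PartialEquiv.refl ℂ))
    (trivializationAt ℂ (CanonicalFiber n N) (ι q.1) (coneMap ι κ _)) = _
  rw [trivializationAt_coneMap]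
  rfl

theorem contMDiffAt_fiberCoord [IsManifold (𝓡 n) ∞ L] {l : L}
    (hf : ContDiffAt ℝ ∞ (localFiberCoord (n := n) ι κ l) (extChartAt (𝓡 n) l l)) :
    ContMDiffAt (𝓡 n) 𝓘(ℝ, ℂ) ∞ (fiberCoord ι κ l) l := by
  have h := hf.contMDiffAt.comp l (contMDiffAt_extChartAt (I := 𝓡 n) (n := ∞) (x := l))
  refine h.congr_of_eventuallyEq ?_
  filter_upwards [extChartAt_source_mem_nhds (I := 𝓡 n) l] with l' hl'
  rw [comp_apply, localFiberCoord, (extChartAt (𝓡 n) l).left_inv hl']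

variable [IsManifold (𝓡 n) ∞ L] (hι : ContMDiff (𝓡 n) 𝓘(ℝ, Cn n) ∞ ι)
  (hf : ∀ l, ContDiffAt ℝ ∞ (localFiberCoord (n := n) ι κ l) (extChartAt (𝓡 n) l l))
include hι hf

theorem contMDiff_coneMap :
    ContMDiff ((𝓡 n).prod 𝓘(ℝ, ℝ)) (modelK n) ∞ (coneMap ι κ) := by
  intro q
  rw [Bundle.contMDiffAt_totalSpace]
  constructor
  · exact (hι q.1).comp q contMDiffAt_fst
  · have h1 : ContMDiffAt ((𝓡 n).prod 𝓘(ℝ, ℝ)) 𝓘(ℝ, ℂ) ∞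
        (fun q' : L × ℝ => fiberCoord ι κ q.1 q'.1) q :=
      (contMDiffAt_fiberCoord (hf q.1)).comp q contMDiffAt_fst
    have h2 : ContMDiffAt ((𝓡 n).prod 𝓘(ℝ, ℝ)) 𝓘(ℝ, ℂ) ∞ (fun q' : L × ℝ => (q'.2 : ℂ)) q :=
      Complex.ofRealCLM.contDiff.contMDiff.contMDiffAt.comp q contMDiffAt_snd
    have hmul := (contDiff_mul (𝕜 := ℝ) (𝔸 := ℂ) (n := ∞)).contMDiff.contMDiffAt.comp q
      (h2.prodMk_space h1)
    refine hmul.congr_of_eventuallyEq (Filter.Eventually.of_forall fun q' => ?_)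
    exact congrArg Prod.snd (trivializationAt_coneMap q.1 q')

/-- The product rule for the fibre coordinate `y = a f`. -/
theorem mfderiv_coneMap (q : L × ℝ) (X : EuclideanSpace ℝ (Fin n) × ℝ) :
    (mfderiv ((𝓡 n).prod 𝓘(ℝ, ℝ)) (modelK n) (coneMap ι κ) q X : Cn n × ℂ) =
      (tmap (n := n) ι q.1 X.1, X.2 * fiberVal (κ q.1) +
        q.2 * fderiv ℝ (localFiberCoord (n := n) ι κ q.1) (extChartAt (𝓡 n) q.1 q.1) X.1) := by
  have hmd := (contMDiff_coneMap hι hf q).mdifferentiableAt (by simp)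
  have hx : extChartAt ((𝓡 n).prod 𝓘(ℝ, ℝ)) q q = (extChartAt (𝓡 n) q.1 q.1, q.2) := by
    rw [extChartAt_prod]; rfl
  have hrange : Set.range ((𝓡 n).prod 𝓘(ℝ, ℝ)) = Set.univ :=
    ((𝓡 n).prod 𝓘(ℝ, ℝ)).range_eq_univ
  have hζ := ((contDiffAt_localRep (n := n) (hι q.1)).differentiableAt (by simp)).hasFDerivAt
  have hφ := ((hf q.1).differentiableAt (by simp)).hasFDerivAt
  have hd1 := HasFDerivAt.comp (extChartAt (𝓡 n) q.1 q.1, q.2) hζ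
    (hasFDerivAt_fst (𝕜 := ℝ) (E := EuclideanSpace ℝ (Fin n)) (F := ℝ))
  have hd2 := HasFDerivAt.comp (extChartAt (𝓡 n) q.1 q.1, q.2) hφ
    (hasFDerivAt_fst (𝕜 := ℝ) (E := EuclideanSpace ℝ (Fin n)) (F := ℝ))
  have hd3 := HasFDerivAt.comp (extChartAt (𝓡 n) q.1 q.1, q.2) Complex.ofRealCLM.hasFDerivAt
    (hasFDerivAt_snd (𝕜 := ℝ) (E := EuclideanSpace ℝ (Fin n)) (F := ℝ))
  have hd := hd1.prodMk (hd3.mul hd2)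
  rw [hmd.mfderiv, writtenInExtChartAt_coneMap, hx, hrange, fderivWithin_univ]
  refine (congrArg (fun φ : EuclideanSpace ℝ (Fin n) × ℝ →L[ℝ] Cn n × ℂ => φ X)
    hd.fderiv).trans ?_
  rw [tmap_eq_fderiv (hι q.1), ← fiberCoord_self (κ := κ)]
  refine Prod.ext rfl ?_
  simp [localFiberCoord]
  ring

end Cone

/-! ### The Calabi form on the cone -/

section Calabi

variable {n : ℕ} {N : Type*} [TopologicalSpace N] [ChartedSpace (Cn n) N]
  [IsManifold 𝓘(ℂ, Cn n) ω N] {g : RMetric n N} {t : ℝ}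

theorem IsKahlerEinstein.Gam_I_smul_left (hg : IsKahlerEinstein g t) (x : N) (v w : Cn n) :
    Gam g x (Complex.I • v) w = Complex.I • Gam g x v w := by
  have hd : DifferentiableAt ℝ (chartMetric g x) (extChartAt 𝓘(ℝ, Cn n) x x) :=
    (contDiffAt_chartMetric g x).differentiableAt (by simp)
  have hG : ∀ᶠ z in 𝓝 (extChartAt 𝓘(ℝ, Cn n) x x), IsHermitianInner (chartMetric g x z) := by
    filter_upwards [extChartAt_target_mem_nhds (I := 𝓘(ℝ, Cn n)) x] with z hz
    exact hg.isHermitianInner_chartMetric hz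
  rw [Gam, christoffel_symm hd hG, christoffel_I_smul hd hG (hg.closed x), christoffel_symm hd hG]

/-- The connection form has type `(1, 0)` in the holomorphic frame, as for a Chern connection. Hence
`b` is complex linear and the horizontal distribution is `J`-invariant. -/
theorem IsKahlerEinstein.connForm_I_smul (hg : IsKahlerEinstein g t) (x : N) (v : Cn n) :
    connForm g x (Complex.I • v) = Complex.I * connForm g x v := by
  have hb : (fun i => EuclideanSpace.single i (1 : ℂ)) =
      ⇑(EuclideanSpace.basisFun (Fin n) ℂ).toBasis := by ext i : 1; simp
  simp only [connForm, hb, dzForm_update, hg.Gam_I_smul_left, map_smul, Finsupp.smul_apply,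
    smul_eq_mul, mul_neg, Finset.mul_sum]
  congr 1
  exact Finset.sum_congr rfl fun j _ => mul_left_comm _ _ _

theorem IsKahlerEinstein.vertPart_I_smul (hg : IsKahlerEinstein g t) (p : CanonicalBundle n N)
    (X : Cn n × ℂ) : vertPart g p (Complex.I • X) = Complex.I * vertPart g p X := by
  change Complex.I * X.2 + fiberVal p.snd * connForm g p.proj (Complex.I • X.1) =
    Complex.I * (X.2 + fiberVal p.snd * connForm g p.proj X.1)
  rw [hg.connForm_I_smul]
  ring

theorem IsKahlerEinstein.rSq_nonneg (hg : IsKahlerEinstein g t) (p : CanonicalBundle n N) :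
    0 ≤ rSq g p := by
  have h : rSq g p = dzNormSq g p.proj * Complex.normSq (fiberVal p.snd) := by
    change (((dzNormSq g p.proj : ℝ) : ℂ) * (fiberVal p.snd * conj (fiberVal p.snd))).re = _
    rw [Complex.mul_conj]
    norm_cast
  rw [h]
  exact mul_nonneg (hg.dzNormSq_pos _).le (Complex.normSq_nonneg _)

/-- Nondegeneracy of the vertical part of `ω_u`, through which `Im α` is detected. -/
theorem deriv_calabiProfile_pos (n : ℕ) {t c s : ℝ} (ht : 0 < t) (hc : 0 < c) (hs : 0 ≤ s) :
    0 < deriv (calabiProfile n t c) s := by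
  have hpos : 0 < t * s + c := by positivity
  have h1 : HasDerivAt (fun s => t * s + c) t s := by
    simpa using ((hasDerivAt_id s).const_mul t).add_const c
  have h2 : HasDerivAt (calabiProfile n t c) _ s :=
    h1.rpow_const (p := (1 : ℝ) / (n + 1)) (Or.inl hpos.ne')
  rw [h2.deriv]
  positivity

variable {L : Type*} [TopologicalSpace L] [ChartedSpace (EuclideanSpace ℝ (Fin n)) L]
  {ι : L → N} {κ : ∀ l, CanonicalFiber n N (ι l)}

/-- The covariant derivative of `κ` along `ι`, divided by `κ`. -/
def connCoeff (g : RMetric n N) (ι : L → N) (κ : ∀ l, CanonicalFiber n N (ι l)) (l : L)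
    (u : EuclideanSpace ℝ (Fin n)) : ℂ :=
  fderiv ℝ (localFiberCoord (n := n) ι κ l) (extChartAt (𝓡 n) l l) u / fiberVal (κ l) +
    connForm g (ι l) (tmap (n := n) ι l u)

theorem covDerivAlong_eq_covDeriv (hι : ContMDiff (𝓡 n) 𝓘(ℝ, Cn n) ∞ ι) (l : L)
    (v w : EuclideanSpace ℝ (Fin n)) : covDerivAlong g ι l v w =
      covDeriv (chartMetric g (ι l)) (localRep (n := n) ι l) (extChartAt (𝓡 n) l l) v w := by
  rw [covDeriv, ← tmap_eq_fderiv (hι l), localRep_center]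
  rfl

variable [IsManifold (𝓡 n) ∞ L] (hg : IsKahlerEinstein g t) (hι : IsLagrangian g ι)
  {o : ∀ l : L, Orientation ℝ (TangentSpace (𝓡 n) l) (Fin n)} (ho : IsOrientation o)
  (hκ : IsVolumeSection g ι o κ)
include hg hι ho hκ

theorem im_connCoeff {l : L} {v : Basis (Fin n) ℝ (TangentSpace (𝓡 n) l)}
    (hv : IsOrthonormalFrame g ι l v) (u : EuclideanSpace ℝ (Fin n)) :
    (connCoeff g ι κ l u).im = - inn g (ι l) (∑ j, covDerivAlong g ι l (v j) (v j))
      (Complex.I • tmap (n := n) ι l u) := by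
  have hloc := hι.isLocalLagrangian hg l
  have hcenter : chartMetric g (ι l) (localRep (n := n) ι l (extChartAt (𝓡 n) l l)) =
      inn g (ι l) := by rw [localRep_center, chartMetric_center]
  let v' : Basis (Fin n) ℝ (EuclideanSpace ℝ (Fin n)) := v
  obtain ⟨s, hs⟩ := hκ.localFiberCoord_mul_dzForm hι ho l v'
  have hτ := tmap_eq_fderiv (hι.smooth l)
  have hv' : IsOrthonormalFor (chartMetric g (ι l) (localRep (n := n) ι l (extChartAt (𝓡 n) l l)))
      (fderiv ℝ (localRep (n := n) ι l) (extChartAt (𝓡 n) l l)).toLinearMap v' := by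
    rw [hcenter, ← hτ]
    exact hv
  have hf0 : localFiberCoord (n := n) ι κ l (extChartAt (𝓡 n) l l) = fiberVal (κ l) := by
    rw [localFiberCoord, extChartAt_to_inv, fiberCoord_self]
  have key := hloc.im_connection hv'
    ((hκ.contDiffAt_localFiberCoord hg hι ho l).differentiableAt (by simp))
    (by rw [hf0]; exact hκ.ne_zero hg hι l)
    (by filter_upwards [hs] with x hx; rw [hx, Complex.ofReal_im]) u
  rw [hcenter, hf0, ← hτ, localRep_center] at key
  simp only [← covDerivAlong_eq_covDeriv hι.smooth] at key
  exact key

/-- By `im_connCoeff`, since the vectors `J ι_* u` are precisely the normal vectors. -/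
theorem isMinimal_iff : IsMinimal g ι ↔ ∀ l u, (connCoeff g ι κ l u).im = 0 := by
  constructor
  · intro hmin l u
    obtain ⟨v, hv⟩ := exists_isOrthonormalFrame hg hι l
    rw [im_connCoeff hg hι ho hκ hv, hmin l v hv, neg_zero]
    exact fun w => hι.lagrangian l u w
  · intro h l v hv ν hν
    obtain ⟨u, rfl⟩ := (hι.isLagrangianMap l).exists_of_normal (hg.isHermitianInner (ι l))
      (v := v) hv hν
    have h1 := im_connCoeff hg hι ho hκ hv u
    rw [h l u] at h1
    exact neg_eq_zero.1 h1.symm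

theorem vertPart_mfderiv_coneMap (q : L × ℝ) (X : EuclideanSpace ℝ (Fin n) × ℝ) :
    vertPart g (coneMap ι κ q) (mfderiv ((𝓡 n).prod 𝓘(ℝ, ℝ)) (modelK n) (coneMap ι κ) q X) =
      fiberVal (κ q.1) * (X.2 + q.2 * connCoeff g ι κ q.1 X.1) := by
  have h1 := mfderiv_coneMap hι.smooth (hκ.contDiffAt_localFiberCoord hg hι ho) q X
  refine (congrArg (vertPart g (coneMap ι κ q)) h1).trans ?_
  change _ + (q.2 * fiberVal (κ q.1)) * connForm g (ι q.1) (tmap (n := n) ι q.1 X.1) = _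
  have hne := hκ.ne_zero hg hι q.1
  rw [connCoeff]
  field_simp
  ring

/-- The horizontal part is the Kähler form on `L`, hence zero. In the vertical part the factor `κ`
contributes only its squared norm, and `Re (i z) = -Im z`. -/
theorem calabiForm_coneMap (u : ℝ → ℝ) (q : L × ℝ) (X Y : EuclideanSpace ℝ (Fin n) × ℝ) :
    calabiForm g t u (coneMap ι κ q)
        (mfderiv ((𝓡 n).prod 𝓘(ℝ, ℝ)) (modelK n) (coneMap ι κ) q X)
        (mfderiv ((𝓡 n).prod 𝓘(ℝ, ℝ)) (modelK n) (coneMap ι κ) q Y) =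
      -(2 * t⁻¹ * deriv u (rSq g (coneMap ι κ q)) * dzNormSq g (ι q.1) *
        Complex.normSq (fiberVal (κ q.1))) *
        ((X.2 + q.2 * connCoeff g ι κ q.1 X.1) *
          conj (Y.2 + q.2 * connCoeff g ι κ q.1 Y.1)).im := by
  have hX := mfderiv_coneMap hι.smooth (hκ.contDiffAt_localFiberCoord hg hι ho) q X
  have hY := mfderiv_coneMap hι.smooth (hκ.contDiffAt_localFiberCoord hg hι ho) q Y
  have vX := vertPart_mfderiv_coneMap hg hι ho hκ q X
  have vY := vertPart_mfderiv_coneMap hg hι ho hκ q Y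
  set dX : Cn n × ℂ := mfderiv ((𝓡 n).prod 𝓘(ℝ, ℝ)) (modelK n) (coneMap ι κ) q X
  set dY : Cn n × ℂ := mfderiv ((𝓡 n).prod 𝓘(ℝ, ℝ)) (modelK n) (coneMap ι κ) q Y
  have hlag : inn g (ι q.1) (Complex.I • dX.1) dY.1 = 0 := by
    rw [hX, hY]
    exact hι.lagrangian q.1 X.1 Y.1
  change u (rSq g (coneMap ι κ q)) * inn g (ι q.1) (Complex.I • dX.1) dY.1 + t⁻¹ *
    deriv u (rSq g (coneMap ι κ q)) * (2 * (((dzNormSq g (ι q.1) : ℝ) : ℂ) *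
      (vertPart g (coneMap ι κ q) (Complex.I • dX) * conj (vertPart g (coneMap ι κ q) dY))).re) = _
  rw [hlag, hg.vertPart_I_smul, vX, vY]
  have h : Complex.I * (fiberVal (κ q.1) * (X.2 + q.2 * connCoeff g ι κ q.1 X.1)) *
      conj (fiberVal (κ q.1) * (Y.2 + q.2 * connCoeff g ι κ q.1 Y.1)) =
      ((Complex.normSq (fiberVal (κ q.1)) : ℝ) : ℂ) * (Complex.I *
        ((X.2 + q.2 * connCoeff g ι κ q.1 X.1) *
          conj (Y.2 + q.2 * connCoeff g ι κ q.1 Y.1))) := by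
    rw [← Complex.mul_conj, map_mul]
    ring
  rw [h, Complex.re_ofReal_mul, Complex.re_ofReal_mul, Complex.I_mul_re]
  ring

theorem im_holVolumeForm_coneMap (q : L × ℝ) (X : Fin (n + 1) → EuclideanSpace ℝ (Fin n) × ℝ) :
    (holVolumeForm (coneMap ι κ q) fun i =>
      mfderiv ((𝓡 n).prod 𝓘(ℝ, ℝ)) (modelK n) (coneMap ι κ) q (X i)).im = 0 := by
  have hf := hκ.contDiffAt_localFiberCoord hg hι ho
  set x₀ := extChartAt (𝓡 n) q.1 q.1
  set f := localFiberCoord (n := n) ι κ q.1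
  let τ : EuclideanSpace ℝ (Fin n) →L[ℝ] Cn n := tmap (n := n) ι q.1
  have hreal : ∀ w : Fin n → EuclideanSpace ℝ (Fin n),
      (fiberVal (κ q.1) * dzForm n fun j => τ (w j)).im = 0 := by
    intro w
    have h1 := dzForm_real_basis (tmap (n := n) ι q.1).toLinearMap (tangentBasis q.1) w
    have h2 := hκ q.1 (tangentBasis q.1)
    change (fiberVal (κ q.1) * dzForm n fun j => (tmap (n := n) ι q.1).toLinearMap (w j)).im = 0
    rw [h1, mul_left_comm]
    erw [h2]
    rw [← Complex.ofReal_mul, Complex.ofReal_im]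
  -- This is `df ∧ τ^*dz`, written as the exterior derivative of `f` times a form with constant
  -- coefficients, `τ` being frozen at `q.1`. It has degree `n + 1` on an `n`-dimensional space.
  have hzero : ∑ i : Fin (n + 1), (-1 : ℤ) ^ (i : ℕ) •
      (fderiv ℝ f x₀ (X i).1 * dzForm n fun j => τ (i.removeNth X j).1) = 0 := by
    have hd : DifferentiableAt ℝ (fun x => f x • (dzForm n).compContinuousLinearMap τ) x₀ :=
      ((hf q.1).differentiableAt (by simp)).smul_const _
    have h1 := extDeriv_apply hd (fun i => (X i).1)
    have h2 : extDeriv (fun x => f x • (dzForm n).compContinuousLinearMap τ) x₀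
        (fun i => (X i).1) = 0 := by
      refine AlternatingMap.map_linearDependent (extDeriv
        (fun x => f x • (dzForm n).compContinuousLinearMap τ) x₀).toAlternatingMap _ fun hli => ?_
      have := hli.fintype_card_le_finrank
      simp at this
    rw [← h2, h1]
    refine Finset.sum_congr rfl fun i _ => ?_
    congr 1
    have h3 : (fun x => (f x • (dzForm n).compContinuousLinearMap τ)
        (i.removeNth fun i => (X i).1)) =
        fun x => f x * dzForm n fun j => τ (i.removeNth X j).1 := rfl
    rw [h3, fderiv_mul_const ((hf q.1).differentiableAt (by simp))]
    exact mul_comm _ _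
  have hX : (fun i => (mfderiv ((𝓡 n).prod 𝓘(ℝ, ℝ)) (modelK n) (coneMap ι κ) q (X i) :
      Cn n × ℂ)) = fun i => (τ (X i).1, (X i).2 * fiberVal (κ q.1) +
        q.2 * fderiv ℝ f x₀ (X i).1) :=
    funext fun i => mfderiv_coneMap hι.smooth hf q (X i)
  refine (congrArg (fun Y : Fin (n + 1) → Cn n × ℂ =>
    (holVolumeForm (coneMap ι κ q) Y).im) hX).trans ?_
  rw [holVolumeForm_apply]
  have hsplit : ∀ i : Fin (n + 1), (-1 : ℤ) ^ (i : ℕ) •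
      (((X i).2 * fiberVal (κ q.1) + q.2 * fderiv ℝ f x₀ (X i).1) *
        dzForm n fun j => τ (i.removeNth X j).1) =
      (((-1) ^ (i : ℕ) * (X i).2 : ℝ) : ℂ) *
        (fiberVal (κ q.1) * dzForm n fun j => τ (i.removeNth X j).1) +
      q.2 * ((-1 : ℤ) ^ (i : ℕ) •
        (fderiv ℝ f x₀ (X i).1 * dzForm n fun j => τ (i.removeNth X j).1)) := by
    intro i
    simp only [zsmul_eq_mul]
    push_cast
    ring
  change (∑ i : Fin (n + 1), (-1 : ℤ) ^ (i : ℕ) •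
      (((X i).2 * fiberVal (κ q.1) + q.2 * fderiv ℝ f x₀ (X i).1) *
        dzForm n fun j => τ (i.removeNth X j).1)).im = 0
  rw [Finset.sum_congr rfl fun i _ => hsplit i, Finset.sum_add_distrib, ← Finset.mul_sum, hzero,
    mul_zero, add_zero, Complex.im_sum]
  refine Finset.sum_eq_zero fun i _ => ?_
  rw [Complex.im_ofReal_mul, hreal, mul_zero]

theorem mfderiv_coneMap_injective (q : L × ℝ) :
    Injective (mfderiv ((𝓡 n).prod 𝓘(ℝ, ℝ)) (modelK n) (coneMap ι κ) q) := by
  refine (injective_iff_map_eq_zero _).2 fun X hX => ?_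
  have h1 := (mfderiv_coneMap hι.smooth (hκ.contDiffAt_localFiberCoord hg hι ho) q X).symm.trans hX
  have h2 : X.1 = 0 := hι.immersion q.1 ((congrArg Prod.fst h1).trans (map_zero _).symm)
  have h3 := congrArg Prod.snd h1
  simp only [h2, map_zero, mul_zero, add_zero] at h3
  have h4 : X.2 = 0 := by
    simpa using (mul_eq_zero.1 h3).resolve_right (hκ.ne_zero hg hι q.1)
  exact Prod.ext h2 h4

theorem isSpecialLagrangian_coneMap_iff (ht : 0 < t) {c : ℝ} (hc : 0 < c) :
    IsSpecialLagrangian g t (calabiProfile n t c) ((𝓡 n).prod 𝓘(ℝ, ℝ)) (coneMap ι κ) ↔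
      ∀ l u, (connCoeff g ι κ l u).im = 0 := by
  constructor
  · intro h l u
    -- The test is made at `a = 1`, because on the zero section `α` drops out of the vertical part.
    have h1 := h.lagrangian (l, 1) ((0, 1) : EuclideanSpace ℝ (Fin n) × ℝ)
      ((u, 0) : EuclideanSpace ℝ (Fin n) × ℝ)
    have h2 := calabiForm_coneMap hg hι ho hκ (calabiProfile n t c) (l, 1)
      ((0, 1) : EuclideanSpace ℝ (Fin n) × ℝ) ((u, 0) : EuclideanSpace ℝ (Fin n) × ℝ)
    have h3 := h2.symm.trans h1
    have hu := deriv_calabiProfile_pos n ht hc (hg.rSq_nonneg (coneMap ι κ (l, 1)))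
    have hd := hg.dzNormSq_pos (ι l)
    have hn := Complex.normSq_pos.2 (hκ.ne_zero hg hι l)
    have h4 := (mul_eq_zero.1 h3).resolve_left (neg_ne_zero.2 (by positivity))
    -- `connForm` is not bundled as a linear map; its value at `0` is fixed by multiplication with
    -- `i`, hence zero.
    have h0 : connCoeff g ι κ l 0 = 0 := by
      have hb : connForm g (ι l) 0 = 0 := by
        have := hg.connForm_I_smul (ι l) 0
        rw [smul_zero] at this
        have hI : (1 - Complex.I) * connForm g (ι l) 0 = 0 := by linear_combination this
        refine (mul_eq_zero.1 hI).resolve_left fun h => ?_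
        simpa using congrArg Complex.im h
      rw [connCoeff, map_zero, zero_div, zero_add]
      exact (congrArg (connForm g (ι l)) (map_zero (tmap (n := n) ι l))).trans hb
    simpa [h0] using h4
  · intro h
    have hfs := hκ.contDiffAt_localFiberCoord hg hι ho
    refine ⟨by simp, contMDiff_coneMap hι.smooth hfs, mfderiv_coneMap_injective hg hι ho hκ, ?_,
      fun q v => im_holVolumeForm_coneMap hg hι ho hκ q v⟩
    intro q X Y
    refine (calabiForm_coneMap hg hι ho hκ (calabiProfile n t c) q X Y).trans ?_
    have hX := h q.1 X.1
    have hY := h q.1 Y.1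
    refine mul_eq_zero_of_right _ ?_
    simp [Complex.mul_im, hX, hY]

end Calabi

end

end MinLag

open MinLag

theorem lemma1 {n : ℕ} {N : Type*} [TopologicalSpace N] [ChartedSpace (Cn n) N]
    [IsManifold 𝓘(ℂ, Cn n) ω N] (g : RMetric n N) (t : ℝ) (ht : 0 < t) (hg : IsKahlerEinstein g t)
    (c : ℝ) (hc : 0 < c)
    {L : Type*} [TopologicalSpace L] [ChartedSpace (EuclideanSpace ℝ (Fin n)) L]
    [IsManifold (𝓡 n) ∞ L]
    (o : ∀ l : L, Orientation ℝ (TangentSpace (𝓡 n) l) (Fin n)) (ho : IsOrientation o)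
    (ι : L → N) (hι : IsLagrangian g ι) :
    ∃ κ : ∀ l, CanonicalFiber n N (ι l),
      (∀ l a, RestrictsToVolume g ι o l a ↔ a = κ l) ∧
      (Topology.IsEmbedding ι → Topology.IsEmbedding (coneMap ι κ)) ∧
      (IsMinimal g ι ↔
        IsSpecialLagrangian g t (calabiProfile n t c) ((𝓡 n).prod 𝓘(ℝ, ℝ)) (coneMap ι κ)) := by
  obtain ⟨κ, hκ⟩ := exists_isVolumeSection hg hι (o := o)
  have hf := hκ.contDiffAt_localFiberCoord hg hι ho
  refine ⟨κ, restrictsToVolume_iff hg hι hκ, fun hemb => ?_, ?_⟩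
  · exact isEmbedding_coneMap hemb (hκ.ne_zero hg hι)
      (fun l => (contMDiffAt_fiberCoord (hf l)).continuousAt)
      (contMDiff_coneMap hι.smooth hf).continuous
  · rw [isMinimal_iff hg hι ho hκ, isSpecialLagrangian_coneMap_iff hg hι ho hκ ht hc]
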